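/- Let $V$ be a vector space (over a field or division ring) of finite dimension $n$, let $1<k<n-1$, let $W\subseteq V$ be a subspace, and let $m$ be a non-negative integer with $k-(n-\dim W)\le m\le \min(k,\dim W)$; exclude the case $\dim W=m=k$, in which there is only one point. **The spine space.** The Grassmann space $\mathfrak A$ has as points the $k$-dimensional subspaces of $V$ and as lines the sets $\{U:\dim U=k,\ H\subset U\subset B\}$ with $\dim H=k-1$, $\dim B=k+1$, $H\subset B$. The spine space $\mathfrak M$ has as points the $k$-dimensional $U\subseteq V$ with $\dim(U\cap W)=m$ (the proper points), and as lines the traces on this point set, of size at least $2$, of lines of $\mathfrak A$; let $\mathcal L$ be its set of lines. A subspace of such a point-line space is a set of points that contains every line with which it shares two points; it is strong if any two of its points are collinear. For $X$ a set of points of $\mathfrak M$, $\overline X$ is the least subspace of $\mathfrak A$ containing $X$. A plane of $\mathfrak A$ is a strong subspace on which $\mathfrak A$ induces a projective plane; a plane of $\mathfrak M$ is a subspace $E$ of $\mathfrak M$ such that $\overline E$ is a plane of $\mathfrak A$. A star (top) of $\mathfrak M$ is a maximal strong subspace of $\mathfrak M$ of the form $\{U\in\mathfrak M: H\subset U\}$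 with $\dim H=k-1$ (of the form $\{U\in\mathfrak M: U\subset B\}$ with $\dim B=k+1$). **Relations on lines.** For $L_1,L_2\in\mathcal L$ write $L_1\,\pi\,L_2$ if some plane of $\mathfrak M$ contains both, and $L_1\,\rho\,L_2$ if there are a plane $E$ of $\mathfrak M$ and a proper point $U\in\overline E$ with $U\in\overline{L_i}\subseteq\overline E$ for $i=1,2$. Let $\delta\in\{\pi,\rho\}$. For a maximal strong subspace $X$ of $\mathfrak M$ and a proper point $U\in\overline X$, the set $\mathcal L_U(X)=\{L\in\mathcal L: U\in\overline L,\ L\subseteq X\}$ is called a proper semibundle. For sets of lines $K_1,K_2$ let $\Upsilon(K_1,K_2)$ mean that there are $L_1\ne L_2$ in $K_1$ and $M_1,M_2$ in $K_2$ with $L_1\,\delta\,M_1$ and $L_2\,\delta\,M_2$, and let $\Upsilon_\emptyset(K_1,K_2)$ mean that $\Upsilon(K_1,K_2)$, $\Upsilon(K_2,K_1)$, and either $K_1\cap K_2=\emptyset$ or $K_1=K_2$. **Statement.** Consider the conditions - (S) $4\le n-k$ and $\dim W\ne m+1$; - (T) $4\le k-m$ and $k\ne m+1$, and assume that (S) or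 (T) holds. 1. For all proper semibundles $K_i=\mathcal L_{U_i}(X_i)$, $i=1,2$, the relation $\Upsilon_\emptyset(K_1,K_2)$ holds if and only if $U_1=U_2$ and $X_1,X_2$ are both stars or both tops. 2. Let $\mathcal B$ be the family of all proper semibundles $\mathcal L_{U}(X)$ for which $X$ is a star and (S) holds, or $X$ is a top and (T) holds. If $X$ is a maximal strong subspace of $\mathfrak M$, $U\in X$, and either $X$ is a star and (S) holds or $X$ is a top and (T) holds, then $$\bigcup\{K' : K' \text{ a proper semibundle},\ \Upsilon_\emptyset(\mathcal L_U(X),K')\}=\bigcup\{K'\in\mathcal B : \Upsilon_\emptyset(\mathcal L_U(X),K')\}=\{L\in\mathcal L: U\in L\}.$$ -/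

import Mathlib

/-- A point-line structure: a set of points together with a family of sets of points (lines). -/
structure PointLine (P : Type*) where
  points : Set P
  lines : Set (Set P)

namespace PointLine

/-- A subspace: a set of points containing every line with which it shares two points. -/
def IsSubspace {P : Type*} (A : PointLine P) (X : Set P) : Prop :=
  X ⊆ A.points ∧ ∀ L ∈ A.lines, (L ∩ X).Nontrivial → L ⊆ X

/-- A strong subspace: a subspace in which any two points are collinear. -/
def IsStrong {P : Type*} (A : PointLine P) (X : Set P) : Prop :=
  A.IsSubspace X ∧ ∀ a ∈ X, ∀ b ∈ X, a ≠ b → ∃ L ∈ A.lines, a ∈ L ∧ b ∈ L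

/-- The smallest subspace of `A` containing `X`. -/
def closure {P : Type*} (A : PointLine P) (X : Set P) : Set P :=
  ⋂₀ {Y | A.IsSubspace Y ∧ X ⊆ Y}

/-- Points of the restriction of `A` to `E`. -/
def RestrPoint {P : Type*} (_A : PointLine P) (E : Set P) : Type _ := {p : P // p ∈ E}

/-- Lines of the restriction of `A` to `E`. -/
def RestrLine {P : Type*} (A : PointLine P) (E : Set P) : Type _ :=
  {L : Set P // L ∈ A.lines ∧ L ⊆ E}

instance instMembershipRestr {P : Type*} (A : PointLine P) (E : Set P) :
    Membership (A.RestrPoint E) (A.RestrLine E) :=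
  ⟨fun L p => p.1 ∈ L.1⟩

/-- A plane of `A`: a strong subspace on which `A` induces a projective plane. -/
def IsPlane {P : Type*} (A : PointLine P) (E : Set P) : Prop :=
  A.IsStrong E ∧ Nonempty (Configuration.ProjectivePlane (A.RestrPoint E) (A.RestrLine E))

/-- The fragment of `A` on the set `S` of proper points. -/
def fragment {P : Type*} (A : PointLine P) (S : Set P) : PointLine P where
  points := A.points ∩ S
  lines := {L | ∃ g ∈ A.lines, L = g ∩ S ∧ (g ∩ S).Nontrivial}

/-- A plane of the fragment: a subspace of the fragment whose closure is a plane of `A`. -/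
def IsFragPlane {P : Type*} (A : PointLine P) (S : Set P) (E : Set P) : Prop :=
  (A.fragment S).IsSubspace E ∧ A.IsPlane (A.closure E)

/-- Coplanarity of two lines of the fragment (the relation `π`). -/
def Coplanar {P : Type*} (A : PointLine P) (S : Set P) (L₁ L₂ : Set P) : Prop :=
  L₁ ∈ (A.fragment S).lines ∧ L₂ ∈ (A.fragment S).lines ∧
    ∃ E, A.IsFragPlane S E ∧ L₁ ⊆ E ∧ L₂ ⊆ E

/-- The set of lines of the fragment with vertex `U` on the plane `E`. For a line `L` of the
fragment, `A.closure L` is the unique line of `A` containing `L`. -/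
def pencil {P : Type*} (A : PointLine P) (S : Set P) (U : P) (E : Set P) : Set (Set P) :=
  {L | L ∈ (A.fragment S).lines ∧ U ∈ A.closure L ∧ A.closure L ⊆ A.closure E}

/-- Two lines of the fragment lie in one pencil of lines, i.e. a pencil whose vertex is a
proper point (the relation `ρ`). -/
def Copencil {P : Type*} (A : PointLine P) (S : Set P) (L₁ L₂ : Set P) : Prop :=
  ∃ E U, A.IsFragPlane S E ∧ U ∈ (A.fragment S).points ∧ U ∈ A.closure E ∧
    L₁ ∈ A.pencil S U E ∧ L₂ ∈ A.pencil S U E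

/-- The set of all lines of the fragment that lie in `X` and whose closure contains `U`. -/
def linesThrough {P : Type*} (A : PointLine P) (S : Set P) (U : P) (X : Set P) :
    Set (Set P) :=
  {L | L ∈ (A.fragment S).lines ∧ U ∈ A.closure L ∧ L ⊆ X}

/-- `X` is a maximal strong subspace of the fragment and `U` is a proper point of its closure,
so that `A.linesThrough S U X` is a proper semibundle. -/
def IsProperVertex {P : Type*} (A : PointLine P) (S : Set P) (U : P) (X : Set P) : Prop :=
  Maximal (A.fragment S).IsStrong X ∧ U ∈ (A.fragment S).points ∧ U ∈ A.closure X

end PointLine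

/-- The relation `Υ` on sets of lines, for a binary relation `δ` on lines. -/
def Upsilon {P : Type*} (δ : Set P → Set P → Prop) (K₁ K₂ : Set (Set P)) : Prop :=
  ∃ L₁ ∈ K₁, ∃ L₂ ∈ K₁, ∃ M₁ ∈ K₂, ∃ M₂ ∈ K₂, L₁ ≠ L₂ ∧ δ L₁ M₁ ∧ δ L₂ M₂

/-- The relation `Υ_∅` on sets of lines. -/
def UpsilonEmpty {P : Type*} (δ : Set P → Set P → Prop) (K₁ K₂ : Set (Set P)) : Prop :=
  Upsilon δ K₁ K₂ ∧ Upsilon δ K₂ K₁ ∧ (K₁ ∩ K₂ = ∅ ∨ K₁ = K₂)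

/-- The union of all members of the family `B` that are `Υ_∅`-related to `K`. -/
def upsilonUnion {P : Type*} (δ : Set P → Set P → Prop) (B : Set (Set (Set P)))
    (K : Set (Set P)) : Set (Set P) :=
  ⋃₀ {K' | K' ∈ B ∧ UpsilonEmpty δ K K'}

namespace Spine

/-- The Grassmann space of `k`-dimensional subspaces of `V`, with `k`-pencils as lines. -/
def grassmann (F V : Type*) [DivisionRing F] [AddCommGroup V] [Module F V] (k : ℕ) :
    PointLine (Submodule F V) where
  points := {U : Submodule F V | Module.finrank F U = k}
  lines := {p | ∃ H B : Submodule F V, Module.finrank F H + 1 = k ∧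
    Module.finrank F B = k + 1 ∧ H ≤ B ∧
    p = {U : Submodule F V | Module.finrank F U = k ∧ H ≤ U ∧ U ≤ B}}

/-- The points of the spine space: `k`-dimensional subspaces meeting `W` in dimension `m`. The
spine space is the fragment of the Grassmann space on this set. -/
def points {F V : Type*} [DivisionRing F] [AddCommGroup V] [Module F V]
    (k m : ℕ) (W : Submodule F V) : Set (Submodule F V) :=
  {U | Module.finrank F U = k ∧ Module.finrank F (U ⊓ W : Submodule F V) = m}

/-- `X` is a star of the Grassmann space restricted to the spine space. -/
def IsStar {F V : Type*} [DivisionRing F] [AddCommGroup V] [Module F V]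
    (k m : ℕ) (W : Submodule F V) (X : Set (Submodule F V)) : Prop :=
  ∃ H : Submodule F V, Module.finrank F H + 1 = k ∧ X = {U : Submodule F V | U ∈ points k m W ∧ H ≤ U}

/-- `X` is a top of the Grassmann space restricted to the spine space. -/
def IsTop {F V : Type*} [DivisionRing F] [AddCommGroup V] [Module F V]
    (k m : ℕ) (W : Submodule F V) (X : Set (Submodule F V)) : Prop :=
  ∃ B : Submodule F V, Module.finrank F B = k + 1 ∧ X = {U : Submodule F V | U ∈ points k m W ∧ U ≤ B}

/-- The numerical condition on stars: `4 ≤ n - k` and `dim W ≠ m + 1`. -/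
def StarCond {F V : Type*} [DivisionRing F] [AddCommGroup V] [Module F V]
    (k m : ℕ) (W : Submodule F V) : Prop :=
  k + 4 ≤ Module.finrank F V ∧ Module.finrank F W ≠ m + 1

/-- The numerical condition on tops: `4 ≤ k - m` and `k ≠ m + 1`. -/
def TopCond (k m : ℕ) : Prop :=
  m + 4 ≤ k ∧ k ≠ m + 1

/-- The type of `X` (star or top) is one for which the numerical condition holds. -/
def Admissible {F V : Type*} [DivisionRing F] [AddCommGroup V] [Module F V]
    (k m : ℕ) (W : Submodule F V) (X : Set (Submodule F V)) : Prop :=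
  (IsStar k m W X ∧ StarCond k m W) ∨ (IsTop k m W X ∧ TopCond k m)

/-- All proper semibundles of the spine space (over maximal strong subspaces). -/
def properSemibundles {F V : Type*} [DivisionRing F] [AddCommGroup V] [Module F V]
    (k m : ℕ) (W : Submodule F V) : Set (Set (Set (Submodule F V))) :=
  {K | ∃ U X, (grassmann F V k).IsProperVertex (points k m W) U X ∧
    K = (grassmann F V k).linesThrough (points k m W) U X}

/-- The proper semibundles over maximal strong subspaces of an admissible type: all proper star
semibundles, all proper top semibundles, or all of both, according to which of the two numerical
conditions hold. -/
def admissibleSemibundles {F V : Type*} [DivisionRing F] [AddCommGroup V] [Module F V]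
    (k m : ℕ) (W : Submodule F V) : Set (Set (Set (Submodule F V))) :=
  {K | ∃ U X, (grassmann F V k).IsProperVertex (points k m W) U X ∧ Admissible k m W X ∧
    K = (grassmann F V k).linesThrough (points k m W) U X}

end Spine

/-- A rank function of total rank `n` on a bounded lattice: strictly monotone and modular, with all
intermediate ranks attained on intervals, relative complements, and at least three elements
strictly inside every interval of length two. These axioms are self-dual. -/
structure IsRank {α : Type*} [Lattice α] [BoundedOrder α] (d : α → ℕ) (n : ℕ) : Prop where
  mono : ∀ {x y : α}, x ≤ y → d x ≤ d y
  eq_of_le : ∀ {x y : α}, x ≤ y → d y ≤ d x → x = y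
  modular : ∀ x y : α, d (x ⊔ y) + d (x ⊓ y) = d x + d y
  bot : d ⊥ = 0
  top : d ⊤ = n
  compl : ∀ {x c y : α}, x ≤ c → c ≤ y → ∃ c', c ⊓ c' = x ∧ c ⊔ c' = y
  chain : ∀ {x y : α} {j : ℕ}, x ≤ y → d x ≤ j → j ≤ d y → ∃ c, x ≤ c ∧ c ≤ y ∧ d c = j
  third : ∀ {a b : α}, d a = d b → d (a ⊔ b) = d a + 1 →
    ∃ c, d c = d a ∧ a ⊓ b ≤ c ∧ c ≤ a ⊔ b ∧ c ≠ a ∧ c ≠ b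

/-! ### Ranked modular lattices: duality, covers and cliques -/

namespace IsRank

section Lattice

variable {α : Type*} [Lattice α] [BoundedOrder α] {d : α → ℕ} {n : ℕ}

theorem le_top_rank (R : IsRank d n) (x : α) : d x ≤ n := R.top ▸ R.mono le_top

/-- Corank is a rank function for the reversed order; this is what turns results on stars into
results on tops. -/
theorem dual (R : IsRank d n) : IsRank (α := αᵒᵈ) (fun x : α => n - d x) n where
  mono {x y} h := by
    have := R.mono (α := α) (x := y) (y := x) h
    change n - d x ≤ n - d y
    omega
  eq_of_le {x y} h h' := by
    have h1 := R.le_top_rank x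
    have h2 := R.le_top_rank y
    change n - d y ≤ n - d x at h'
    exact (R.eq_of_le (α := α) (x := y) (y := x) h (by omega)).symm
  modular x y := by
    have h := R.modular x y
    have h1 := R.le_top_rank x
    have h2 := R.le_top_rank y
    have h3 := R.le_top_rank (@max α _ x y)
    have h4 := R.le_top_rank (@min α _ x y)
    change (n - d (@min α _ x y)) + (n - d (@max α _ x y)) = (n - d x) + (n - d y)
    omega
  bot := by
    change n - d (⊤ : α) = 0
    rw [R.top, Nat.sub_self]
  top := by
    change n - d (⊥ : α) = n
    rw [R.bot, Nat.sub_zero]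
  compl {x c y} h h' := by
    obtain ⟨c', h1, h2⟩ := R.compl (α := α) (x := y) (c := c) (y := x) h' h
    exact ⟨c', h2, h1⟩
  chain {x y j} h h1 h2 := by
    change n - d x ≤ j at h1
    change j ≤ n - d y at h2
    obtain ⟨c, h3, h4, h5⟩ := R.chain (α := α) (x := y) (y := x) (j := n - j) h
      (by have := R.le_top_rank y; omega) (by omega)
    refine ⟨c, h4, h3, ?_⟩
    omega
  third {a b} h h' := by
    have h1 := R.le_top_rank a
    have h2 := R.le_top_rank b
    have h4 := R.le_top_rank (@min α _ a b)
    have h5 := R.modular a b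
    change n - d a = n - d b at h
    change n - d (@min α _ a b) = n - d a + 1 at h'
    obtain ⟨c, h6, h7, h8, h9⟩ := R.third (a := a) (b := b) (by omega) (by omega)
    refine ⟨c, ?_, h8, h7, h9⟩
    omega

theorem lt_of_le_of_ne (R : IsRank d n) {x y : α} (h : x ≤ y) (hne : x ≠ y) : d x < d y := by
  by_contra hc
  exact hne (R.eq_of_le h (by omega))

/-- A relative complement of one cover `b` has rank `d y - 1 > d x`, so it contains a cover of `x`,
which cannot lie below `b`. -/
theorem exists_two_covers (R : IsRank d n) {x y : α} (h : x ≤ y) (hd : d x + 2 ≤ d y) :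
    ∃ b c, b ≠ c ∧ x ≤ b ∧ b ≤ y ∧ d b = d x + 1 ∧ x ≤ c ∧ c ≤ y ∧ d c = d x + 1 := by
  obtain ⟨b, hxb, hby, hb⟩ := R.chain (j := d x + 1) h (by omega) (by omega)
  obtain ⟨b', h1, h2⟩ := R.compl hxb hby
  have h3 := R.modular b b'
  rw [h1, h2] at h3
  obtain ⟨c, hxc, hcb, hc⟩ := R.chain (x := x) (y := b') (j := d x + 1) (h1 ▸ inf_le_right)
    (by omega) (by omega)
  refine ⟨b, c, ?_, hxb, hby, hb, hxc, hcb.trans (h2 ▸ le_sup_right), hc⟩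
  rintro rfl
  rw [inf_eq_left.2 hcb] at h1
  rw [h1] at hb
  omega

/-- Two distinct elements of rank `k` between `x` and `y`, where `x` has rank `k - 1` and `y` has
rank `k + 1`, have meet `x` and join `y`. -/
theorem inf_eq_sup_eq (R : IsRank d n) {k : ℕ} {x y a b : α} (hx : d x + 1 = k) (hy : d y = k + 1)
    (ha : d a = k) (hb : d b = k) (hab : a ≠ b) (hxa : x ≤ a) (hxb : x ≤ b) (hay : a ≤ y)
    (hby : b ≤ y) : a ⊓ b = x ∧ a ⊔ b = y := by
  have h := R.modular a b
  have h1 : d a < d (a ⊔ b) := R.lt_of_le_of_ne le_sup_left fun hc =>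
    hab (R.eq_of_le (by rw [hc]; exact le_sup_right) (by omega)).symm
  have h2 := R.mono (le_inf hxa hxb)
  have h3 := R.mono (sup_le hay hby)
  exact ⟨(R.eq_of_le (le_inf hxa hxb) (by omega)).symm, R.eq_of_le (sup_le hay hby) (by omega)⟩

theorem sup_rank_of_inf (R : IsRank d n) {k : ℕ} {x a b : α} (hx : d x + 1 = k)
    (ha : d a = k) (hb : d b = k) (hab : a ≠ b) (hxa : x ≤ a) (hxb : x ≤ b) :
    d (a ⊔ b) = k + 1 ∧ a ⊓ b = x := by
  have h := R.modular a b
  have h1 : d a < d (a ⊔ b) := R.lt_of_le_of_ne le_sup_left fun hc =>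
    hab (R.eq_of_le (by rw [hc]; exact le_sup_right) (by omega)).symm
  have h2 := R.mono (le_inf hxa hxb)
  exact ⟨by omega, (R.eq_of_le (le_inf hxa hxb) (by omega)).symm⟩

/-- A clique of pairwise adjacent elements of rank `k` has a common lower or upper neighbour. -/
theorem clique (R : IsRank d n) {k : ℕ} {P : Set α} (hP : ∀ a ∈ P, d a = k)
    (hadj : ∀ a ∈ P, ∀ b ∈ P, a ≠ b → d (a ⊓ b) + 1 = k)
    {a b : α} (ha : a ∈ P) (hb : b ∈ P) (hab : a ≠ b) :
    (∀ u ∈ P, a ⊓ b ≤ u) ∨ ∀ u ∈ P, u ≤ a ⊔ b := by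
  have hin : d (a ⊓ b) + 1 = k := hadj a ha b hb hab
  have key : ∀ u ∈ P, a ⊓ b ≤ u ∨ u ≤ a ⊔ b := by
    intro u hu
    by_cases hua : u = a
    · exact Or.inl (hua ▸ inf_le_left)
    by_cases hub : u = b
    · exact Or.inl (hub ▸ inf_le_right)
    -- If the traces of `a` and `b` on `u` agree, they fill `a ⊓ b`; otherwise two distinct elements
    -- of rank `k - 1` join to `u`, forcing `u ≤ a ⊔ b`.
    by_cases he : u ⊓ a = u ⊓ b
    · left
      have h1 : u ⊓ a ≤ a ⊓ b := le_inf inf_le_right (he ▸ inf_le_right)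
      have h2 := hadj u hu a ha hua
      rw [← R.eq_of_le h1 (by omega)]
      exact inf_le_left
    · right
      have h2 := hadj u hu a ha hua
      have h3 := hadj u hu b hb hub
      have h4 : d (u ⊓ a) < d (u ⊓ a ⊔ u ⊓ b) := R.lt_of_le_of_ne le_sup_left fun hc =>
        he (R.eq_of_le (by rw [hc]; exact le_sup_right) (by omega)).symm
      have h5 : u ⊓ a ⊔ u ⊓ b = u := R.eq_of_le (sup_le inf_le_left inf_le_left)
        (by have := hP u hu; omega)
      rw [← h5]
      exact sup_le_sup inf_le_right inf_le_right
  by_contra hc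
  push Not at hc
  obtain ⟨⟨v, hv, hv'⟩, u, hu, hu'⟩ := hc
  have hu1 : a ⊓ b ≤ u := (key u hu).resolve_right hu'
  have hv1 : v ≤ a ⊔ b := (key v hv).resolve_left hv'
  have huv : u ≠ v := by
    rintro rfl
    exact hv' hu1
  -- One `u` not below the join and one `v` not above the meet cannot coexist: `u` meets `a ⊔ b`
  -- only in `a ⊓ b`, so `u ⊓ v` equals `a ⊓ b`.
  have h1 : d (u ⊓ (a ⊔ b)) < d u := R.lt_of_le_of_ne inf_le_left fun h => hu' (inf_eq_left.1 h)
  have h2 := R.eq_of_le (le_inf hu1 (inf_le_left.trans le_sup_left) : a ⊓ b ≤ u ⊓ (a ⊔ b))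
    (by have := hP u hu; omega)
  have h3 : u ⊓ v ≤ a ⊓ b := h2 ▸ inf_le_inf_left u hv1
  have h4 := R.eq_of_le h3 (by have := hadj u hu v hv huv; omega)
  exact hv' (h4 ▸ inf_le_right)

end Lattice

end IsRank

/-! ### Subspaces of a vector space satisfy the rank axioms -/

theorem Submodule.isRank_finrank {F V : Type*} [DivisionRing F] [AddCommGroup V] [Module F V]
    [FiniteDimensional F V] :
    IsRank (fun U : Submodule F V => Module.finrank F U) (Module.finrank F V) where
  mono h := Submodule.finrank_mono h
  eq_of_le h h' := Submodule.eq_of_le_of_finrank_le h h'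
  modular s t := Submodule.finrank_sup_add_finrank_inf_eq s t
  bot := finrank_bot F V
  top := finrank_top F V
  compl {x c y} h h' := by
    obtain ⟨e, he⟩ := exists_isCompl c
    -- A complement of `c` in `V`, cut down to `y` and enlarged by `x`; the modular law verifies
    -- both equations.
    refine ⟨x ⊔ e ⊓ y, ?_, ?_⟩
    · rw [inf_comm, sup_inf_assoc_of_le _ h, inf_comm (e ⊓ y) c, ← inf_assoc, he.inf_eq_bot,
        bot_inf_eq, sup_bot_eq]
    · rw [← sup_assoc, sup_eq_left.2 h, ← sup_inf_assoc_of_le e h', he.sup_eq_top, top_inf_eq]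
  chain {x y j} h h1 h2 := by
    obtain ⟨i, rfl⟩ := Nat.exists_eq_add_of_le h1
    clear h1
    induction i with
    | zero => exact ⟨x, le_rfl, h, rfl⟩
    | succ i ih =>
      obtain ⟨c, hxc, hcy, hc⟩ := ih (by omega)
      have hlt : c < y := lt_of_le_of_ne hcy (by rintro rfl; omega)
      obtain ⟨v, hv, hvc⟩ := SetLike.exists_of_lt hlt
      refine ⟨c ⊔ Submodule.span F {v}, hxc.trans le_sup_left,
        sup_le hcy ((Submodule.span_singleton_le_iff_mem _ _).2 hv), ?_⟩
      have h3 := Submodule.finrank_sup_add_finrank_inf_eq c (Submodule.span F {v})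
      have hv0 : v ≠ 0 := by
        rintro rfl
        exact hvc c.zero_mem
      rw [finrank_span_singleton hv0] at h3
      have h4 : c < c ⊔ Submodule.span F {v} := lt_of_le_of_ne le_sup_left fun he =>
        hvc (he ▸ Submodule.mem_sup_right (Submodule.mem_span_singleton_self v))
      have h5 := Submodule.finrank_lt_finrank_of_lt h4
      omega
  third {a b} h h' := by
    have hmod := Submodule.finrank_sup_add_finrank_inf_eq a b
    have hab : ¬ a ≤ b := by
      intro hc
      rw [sup_eq_right.2 hc] at h'
      omega
    have hba : ¬ b ≤ a := by
      intro hc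
      rw [sup_eq_left.2 hc] at h'
      omega
    obtain ⟨u, hua, hub⟩ := SetLike.not_le_iff_exists.1 hab
    obtain ⟨v, hvb, hva⟩ := SetLike.not_le_iff_exists.1 hba
    -- With `u ∈ a \ b` and `v ∈ b \ a`, the sum lies in neither, so adjoining it to `a ⊓ b` gives a
    -- third subspace.
    have huv : u + v ∉ a := fun hc => hva ((a.add_mem_iff_right hua).1 hc)
    have huv' : u + v ∉ b := fun hc => hub ((b.add_mem_iff_left hvb).1 hc)
    have hmem : u + v ∈ a ⊓ b ⊔ Submodule.span F {u + v} :=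
      Submodule.mem_sup_right (Submodule.mem_span_singleton_self _)
    refine ⟨a ⊓ b ⊔ Submodule.span F {u + v}, ?_, le_sup_left, ?_, ?_, ?_⟩
    · have h0 : u + v ≠ 0 := fun hc => huv (hc ▸ a.zero_mem)
      have h3 := Submodule.finrank_sup_add_finrank_inf_eq (a ⊓ b) (Submodule.span F {u + v})
      rw [finrank_span_singleton h0] at h3
      have h4 : a ⊓ b < a ⊓ b ⊔ Submodule.span F {u + v} := lt_of_le_of_ne le_sup_left fun he =>
        huv (he.symm ▸ hmem : u + v ∈ a ⊓ b).1
      have h5 := Submodule.finrank_lt_finrank_of_lt h4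
      omega
    · refine sup_le (inf_le_left.trans le_sup_left)
        ((Submodule.span_singleton_le_iff_mem _ _).2 ?_)
      exact add_mem (Submodule.mem_sup_left hua) (Submodule.mem_sup_right hvb)
    · intro hc
      exact huv (hc ▸ hmem)
    · intro hc
      exact huv' (hc ▸ hmem)

/-! ### Grassmann spaces over a ranked lattice: lines and closures -/

namespace IsRank

section Grassmann

variable {α : Type*} [Lattice α]

/-- The elements of rank `k` between `x` and `y`. -/
def between (d : α → ℕ) (k : ℕ) (x y : α) : Set α :=
  {U | d U = k ∧ x ≤ U ∧ U ≤ y}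

/-- `x ≤ y` are of rank `k - 1` and `k + 1`, so that `between d k x y` is a line. -/
structure IsFlag (d : α → ℕ) (k : ℕ) (x y : α) : Prop where
  lower : d x + 1 = k
  upper : d y = k + 1
  le : x ≤ y

/-- The Grassmann space of elements of rank `k`. -/
def grass (d : α → ℕ) (k : ℕ) : PointLine α where
  points := {U | d U = k}
  lines := {p | ∃ H B : α, d H + 1 = k ∧ d B = k + 1 ∧ H ≤ B ∧
    p = {U | d U = k ∧ H ≤ U ∧ U ≤ B}}

variable {d : α → ℕ} {n k : ℕ} {x y H B H' B' : α} {S : Set α}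

theorem mem_grass_lines {g : Set α} :
    g ∈ (grass d k).lines ↔ ∃ H B, IsFlag d k H B ∧ g = between d k H B :=
  ⟨fun ⟨H, B, h1, h2, h3, h4⟩ => ⟨H, B, ⟨h1, h2, h3⟩, h4⟩,
    fun ⟨H, B, h, h4⟩ => ⟨H, B, h.1, h.2, h.3, h4⟩⟩

theorem mem_fragment_lines {L : Set α} :
    L ∈ ((grass d k).fragment S).lines ↔
      ∃ H B, IsFlag d k H B ∧ L = between d k H B ∩ S ∧ (between d k H B ∩ S).Nontrivial := by
  constructor
  · rintro ⟨g, hg, hL⟩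
    obtain ⟨H, B, hf, rfl⟩ := mem_grass_lines.1 hg
    exact ⟨H, B, hf, hL⟩
  · rintro ⟨H, B, hf, hL⟩
    exact ⟨_, mem_grass_lines.2 ⟨H, B, hf, rfl⟩, hL⟩

theorem _root_.PointLine.closure_mono {P : Type*} (A : PointLine P) {X Y : Set P} (h : X ⊆ Y) :
    A.closure X ⊆ A.closure Y :=
  fun _ hp Z hZ => hp Z ⟨hZ.1, h.trans hZ.2⟩

theorem _root_.PointLine.subset_closure {P : Type*} (A : PointLine P) (X : Set P) :
    X ⊆ A.closure X :=
  fun _ hp _ hZ => hZ.2 hp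

theorem _root_.PointLine.IsSubspace.closure_subset {P : Type*} {A : PointLine P} {X Y : Set P}
    (hY : A.IsSubspace Y) (h : X ⊆ Y) : A.closure X ⊆ Y :=
  fun _ hp => hp Y ⟨hY, h⟩

theorem between_subset_of_mem {Y : Set α} (hY : (grass d k).IsSubspace Y) (hf : IsFlag d k H B)
    {a b : α} (ha : a ∈ between d k H B) (hb : b ∈ between d k H B) (hab : a ≠ b) (haY : a ∈ Y)
    (hbY : b ∈ Y) : between d k H B ⊆ Y :=
  hY.2 _ (mem_grass_lines.2 ⟨H, B, hf, rfl⟩) ⟨a, ⟨ha, haY⟩, b, ⟨hb, hbY⟩, hab⟩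

variable [BoundedOrder α]

namespace IsFlag

theorem eq_of_mem (hf : IsFlag d k H B) (R : IsRank d n) {a b : α} (ha : a ∈ between d k H B)
    (hb : b ∈ between d k H B) (hab : a ≠ b) : a ⊓ b = H ∧ a ⊔ b = B :=
  R.inf_eq_sup_eq hf.lower hf.upper ha.1 hb.1 hab ha.2.1 hb.2.1 ha.2.2 hb.2.2

theorem eq_of_nontrivial_inter (hf : IsFlag d k H B) (hf' : IsFlag d k H' B') (R : IsRank d n)
    (h : (between d k H B ∩ between d k H' B').Nontrivial) : H = H' ∧ B = B' := by
  obtain ⟨a, ⟨ha, ha'⟩, b, ⟨hb, hb'⟩, hab⟩ := h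
  have h1 := hf.eq_of_mem R ha hb hab
  have h2 := hf'.eq_of_mem R ha' hb' hab
  exact ⟨h1.1.symm.trans h2.1, h1.2.symm.trans h2.2⟩

theorem nontrivial (hf : IsFlag d k H B) (R : IsRank d n) : (between d k H B).Nontrivial := by
  have h1 := hf.lower
  have h2 := hf.upper
  obtain ⟨b, c, hbc, h3, h4, h5, h6, h7, h8⟩ := R.exists_two_covers hf.le (by omega)
  exact ⟨b, ⟨by omega, h3, h4⟩, c, ⟨by omega, h6, h7⟩, hbc⟩

end IsFlag

/-- The elements of rank `k` of an interval form a subspace. -/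
theorem isSubspace_between (R : IsRank d n) (x y : α) :
    (grass d k).IsSubspace (between d k x y) := by
  refine ⟨fun U hU => hU.1, ?_⟩
  rintro L hL ⟨a, ⟨haL, ha⟩, b, ⟨hbL, hb⟩, hab⟩ U hU
  obtain ⟨H, B, hf, rfl⟩ := mem_grass_lines.1 hL
  obtain ⟨rfl, rfl⟩ := hf.eq_of_mem R haL hbL hab
  exact ⟨hU.1, (le_inf ha.2.1 hb.2.1).trans hU.2.1, hU.2.2.trans (sup_le ha.2.2 hb.2.2)⟩

/-- Two points of a trace already force the whole Grassmann line, so closures of spine lines can be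
replaced by flags. -/
theorem closure_trace (R : IsRank d n) (hf : IsFlag d k H B)
    (h : (between d k H B ∩ S).Nontrivial) :
    (grass d k).closure (between d k H B ∩ S) = between d k H B := by
  apply Set.Subset.antisymm
  · exact (isSubspace_between R H B).closure_subset Set.inter_subset_left
  · rintro U hU Y ⟨hY, hYs⟩
    obtain ⟨a, ha, b, hb, hab⟩ := h
    exact between_subset_of_mem hY hf ha.1 hb.1 hab (hYs ha) (hYs hb) hU

theorem exists_isFlag_of_inf (R : IsRank d n) {a b : α} (hx : d x + 1 = k) (ha : d a = k)
    (hb : d b = k) (hab : a ≠ b) (hxa : x ≤ a) (hxb : x ≤ b) :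
    IsFlag d k x (a ⊔ b) ∧ a ∈ between d k x (a ⊔ b) ∧ b ∈ between d k x (a ⊔ b) :=
  ⟨⟨hx, (R.sup_rank_of_inf hx ha hb hab hxa hxb).1, hxa.trans le_sup_left⟩,
    ⟨ha, hxa, le_sup_left⟩, ⟨hb, hxb, le_sup_right⟩⟩

theorem isStrong_between (R : IsRank d n) (hx : d x + 1 = k) (y : α) :
    (grass d k).IsStrong (between d k x y) := by
  refine ⟨isSubspace_between R x y, fun a ha b hb hab => ?_⟩
  obtain ⟨h1, h2, h3⟩ := exists_isFlag_of_inf R hx ha.1 hb.1 hab ha.2.1 hb.2.1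
  exact ⟨_, mem_grass_lines.2 ⟨_, _, h1, rfl⟩, h2, h3⟩

/-! ### Projective planes inside stars -/

section Plane

/-- The line of a star plane with given upper element. -/
def planeLine (hx : d x + 1 = k) {C : α} (hC : d C = k + 1) (hxC : x ≤ C) (hCy : C ≤ y) :
    (grass d k).RestrLine (between d k x y) :=
  ⟨between d k x C, mem_grass_lines.2 ⟨x, C, ⟨hx, hC, hxC⟩, rfl⟩,
    fun _ hU => ⟨hU.1, hU.2.1, hU.2.2.trans hCy⟩⟩

theorem exists_eq_planeLine (R : IsRank d n) (hx : d x + 1 = k)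
    (l : (grass d k).RestrLine (between d k x y)) :
    ∃ C, d C = k + 1 ∧ x ≤ C ∧ C ≤ y ∧ l.1 = between d k x C := by
  obtain ⟨H, B, hf, hl⟩ := mem_grass_lines.1 l.2.1
  obtain ⟨a, ha, b, hb, hab⟩ := hf.nontrivial R
  have hs : between d k H B ⊆ between d k x y := hl ▸ l.2.2
  obtain ⟨rfl, rfl⟩ := hf.eq_of_mem R ha hb hab
  have h1 := R.eq_of_le (le_inf (hs ha).2.1 (hs hb).2.1) (by have := hf.lower; omega)
  exact ⟨a ⊔ b, hf.upper, h1 ▸ hf.le, sup_le (hs ha).2.2 (hs hb).2.2,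
    hl.trans (congrArg (fun z => between d k z (a ⊔ b)) h1.symm)⟩

theorem rank_inf_of_plane (R : IsRank d n) (hy : d y = k + 2) {C D : α}
    (hC : d C = k + 1) (hCy : C ≤ y) (hD : d D = k + 1) (hDy : D ≤ y) (hCD : C ≠ D) :
    d (C ⊓ D) = k := by
  have h1 := R.modular C D
  have h2 := R.mono (sup_le hCy hDy)
  have h3 : d C < d (C ⊔ D) := R.lt_of_le_of_ne le_sup_left fun hc =>
    hCD (R.eq_of_le (by rw [hc]; exact le_sup_right) (by omega)).symm
  omega

/-- This supplies `exists_config` of a projective plane. Take a line `C` with points `a`, `b`, a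
point `p` off `C`, a third point `q` on `pb` and a third point `r` on `ab`. The points are `p`, `a`,
`b` and the lines `pr`, `C`, `aq`. -/
theorem plane_config (R : IsRank d n) (hx : d x + 1 = k) (hy : d y = k + 2) (hxy : x ≤ y) :
    ∃ p₁ ∈ between d k x y, ∃ p₂ ∈ between d k x y, ∃ p₃ ∈ between d k x y, ∃ C₁ C₂ C₃ : α,
      (d C₁ = k + 1 ∧ x ≤ C₁ ∧ C₁ ≤ y) ∧ (d C₂ = k + 1 ∧ x ≤ C₂ ∧ C₂ ≤ y) ∧
      (d C₃ = k + 1 ∧ x ≤ C₃ ∧ C₃ ≤ y) ∧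
      ¬ p₁ ≤ C₂ ∧ ¬ p₁ ≤ C₃ ∧ ¬ p₂ ≤ C₁ ∧ p₂ ≤ C₂ ∧ p₂ ≤ C₃ ∧ ¬ p₃ ≤ C₁ ∧ p₃ ≤ C₂ ∧ ¬ p₃ ≤ C₃ := by
  obtain ⟨C, hxC, hCy, hC⟩ := R.chain (j := k + 1) hxy (by omega) (by omega)
  obtain ⟨p, hpi, hps⟩ := R.compl hxC hCy
  have hmod := R.modular C p
  rw [hpi, hps] at hmod
  have hp : d p = k := by omega
  have hxp : x ≤ p := hpi ▸ inf_le_right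
  have hpy : p ≤ y := hps ▸ le_sup_right
  have hpC : ¬ p ≤ C := by
    intro h
    rw [inf_eq_right.2 h] at hpi
    rw [hpi] at hp
    omega
  obtain ⟨a, b, hab, hxa, haC, ha, hxb, hbC, hb⟩ := R.exists_two_covers hxC (by omega)
  have ha : d a = k := by omega
  have hb : d b = k := by omega
  have hpb : p ≠ b := fun h => hpC (h ▸ hbC)
  have join : ∀ {u v z : α}, d u = k → d v = k → u ≠ v → x ≤ u → x ≤ v → d z = k + 1 → u ≤ z →
      v ≤ z → u ⊔ v = z := fun hu hv huv hxu hxv hz huz hvz =>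
    (R.inf_eq_sup_eq hx hz hu hv huv hxu hxv huz hvz).2
  have rk : ∀ {u v : α}, d u = k → d v = k → u ≠ v → x ≤ u → x ≤ v → d (u ⊔ v) = k + 1 :=
    fun hu hv huv hxu hxv => (R.sup_rank_of_inf hx hu hv huv hxu hxv).1
  obtain ⟨q, hq, hqi, hqs, hqp, hqb⟩ := R.third (a := p) (b := b) (by omega)
    (by rw [rk hp hb hpb hxp hxb, hp])
  have hq : d q = k := by omega
  have hxq : x ≤ q := (le_inf hxp hxb).trans hqi
  obtain ⟨r, hr, hri, hrs, hra, hrb⟩ := R.third (a := a) (b := b) (by omega)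
    (by rw [rk ha hb hab hxa hxb, ha])
  have hr : d r = k := by omega
  have hxr : x ≤ r := (le_inf hxa hxb).trans hri
  have hrC : r ≤ C := hrs.trans (sup_le haC hbC)
  have hpr : p ≠ r := fun h => hpC (h ▸ hrC)
  have hqC : ¬ q ≤ C := by
    intro h
    have h1 := join hq hb hqb hxq hxb hC h hbC
    have h2 := join hq hb hqb hxq hxb (rk hp hb hpb hxp hxb) hqs le_sup_right
    exact hpC (h1 ▸ h2 ▸ le_sup_left)
  have haq : a ≠ q := fun h => hqC (h ▸ haC)
  have hb3 : ¬ b ≤ a ⊔ q := by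
    intro h
    have h1 := join ha hb hab hxa hxb (rk ha hq haq hxa hxq) le_sup_left h
    exact hqC ((le_sup_right.trans h1.ge).trans (sup_le haC hbC))
  have hC1 : ∀ u, d u = k → x ≤ u → u ≤ C → u ≠ r → ¬ u ≤ p ⊔ r := by
    intro u hu hxu huC hur h
    have h1 := join hu hr hur hxu hxr (rk hp hr hpr hxp hxr) h le_sup_right
    exact hpC ((le_sup_left.trans h1.ge).trans (sup_le huC hrC))
  refine ⟨p, ⟨hp, hxp, hpy⟩, a, ⟨ha, hxa, haC.trans hCy⟩, b, ⟨hb, hxb, hbC.trans hCy⟩,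
    p ⊔ r, C, a ⊔ q, ⟨rk hp hr hpr hxp hxr, hxp.trans le_sup_left, sup_le hpy (hrC.trans hCy)⟩,
    ⟨hC, hxC, hCy⟩, ⟨rk ha hq haq hxa hxq, hxa.trans le_sup_left,
      sup_le (haC.trans hCy) (hqs.trans (sup_le hpy (hbC.trans hCy)))⟩,
    hpC, ?_, hC1 a ha hxa haC (Ne.symm hra), haC, le_sup_left, hC1 b hb hxb hbC (Ne.symm hrb),
    hbC, hb3⟩
  intro h
  have h1 := join hp hq (Ne.symm hqp) hxp hxq (rk ha hq haq hxa hxq) h le_sup_right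
  have h2 := join hp hq (Ne.symm hqp) hxp hxq (rk hp hb hpb hxp hxb) le_sup_left hqs
  exact hb3 (h1 ▸ h2 ▸ le_sup_right)

/-- The interval has length three: ranks `k` and `k + 1` are its points and lines, and modularity
makes two lines meet. -/
theorem isPlane_between (R : IsRank d n) (hx : d x + 1 = k) (hy : d y = k + 2) (hxy : x ≤ y) :
    (grass d k).IsPlane (between d k x y) := by
  refine ⟨isStrong_between R hx y, ?_⟩
  have hnd : Configuration.Nondegenerate ((grass d k).RestrPoint (between d k x y))
      ((grass d k).RestrLine (between d k x y)) := by
    refine ⟨fun l => ?_, fun p => ?_, fun {p₁ p₂ l₁ l₂} h₁ h₂ h₃ h₄ => ?_⟩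
    · obtain ⟨C, hC, hxC, hCy, hl⟩ := exists_eq_planeLine R hx l
      obtain ⟨p, hpi, hps⟩ := R.compl hxC hCy
      have hmod := R.modular C p
      rw [hpi, hps] at hmod
      have hp : d p = k := by omega
      refine ⟨⟨p, hp, hpi ▸ inf_le_right, hps ▸ le_sup_right⟩, fun h => ?_⟩
      change p ∈ l.1 at h
      rw [hl] at h
      rw [inf_eq_right.2 h.2.2] at hpi
      rw [hpi] at hp
      omega
    · obtain ⟨p, hp, hxp, hpy⟩ := p
      obtain ⟨C, hpi, hps⟩ := R.compl hxp hpy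
      have hmod := R.modular p C
      rw [hpi, hps] at hmod
      refine ⟨planeLine hx (C := C) (by omega) (hpi ▸ inf_le_right) (hps ▸ le_sup_right), ?_⟩
      intro h
      have h : p ∈ between d k x C := h
      rw [inf_eq_left.2 h.2.2] at hpi
      rw [hpi] at hp
      omega
    · by_contra hc
      push Not at hc
      obtain ⟨C, hC, hxC, hCy, hl⟩ := exists_eq_planeLine R hx l₁
      obtain ⟨D, hD, hxD, hDy, hl'⟩ := exists_eq_planeLine R hx l₂
      change p₁.1 ∈ l₁.1 at h₁
      change p₂.1 ∈ l₁.1 at h₂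
      change p₁.1 ∈ l₂.1 at h₃
      change p₂.1 ∈ l₂.1 at h₄
      rw [hl] at h₁ h₂
      rw [hl'] at h₃ h₄
      have h := IsFlag.eq_of_nontrivial_inter ⟨hx, hC, hxC⟩ ⟨hx, hD, hxD⟩ R
        ⟨p₁.1, ⟨h₁, h₃⟩, p₂.1, ⟨h₂, h₄⟩, fun h => hc.1 (Subtype.ext h)⟩
      exact hc.2 (Subtype.ext (by rw [hl, hl', h.2]))
  have hpt : ∀ l₁ l₂ : (grass d k).RestrLine (between d k x y), l₁ ≠ l₂ →
      ∃ p : (grass d k).RestrPoint (between d k x y), p ∈ l₁ ∧ p ∈ l₂ := by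
    intro l₁ l₂ hl
    obtain ⟨C, hC, hxC, hCy, h⟩ := exists_eq_planeLine R hx l₁
    obtain ⟨D, hD, hxD, hDy, h'⟩ := exists_eq_planeLine R hx l₂
    have hCD : C ≠ D := by
      rintro rfl
      exact hl (Subtype.ext (h.trans h'.symm))
    have hi := rank_inf_of_plane R hy hC hCy hD hDy hCD
    refine ⟨⟨C ⊓ D, hi, le_inf hxC hxD, inf_le_left.trans hCy⟩, ?_, ?_⟩
    · change C ⊓ D ∈ l₁.1
      rw [h]
      exact ⟨hi, le_inf hxC hxD, inf_le_left⟩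
    · change C ⊓ D ∈ l₂.1
      rw [h']
      exact ⟨hi, le_inf hxC hxD, inf_le_right⟩
  have hli : ∀ p₁ p₂ : (grass d k).RestrPoint (between d k x y), p₁ ≠ p₂ →
      ∃ l : (grass d k).RestrLine (between d k x y), p₁ ∈ l ∧ p₂ ∈ l := by
    rintro ⟨a, ha, hxa, hay⟩ ⟨b, hb, hxb, hby⟩ hab
    have hab : a ≠ b := fun h => hab (Subtype.ext h)
    obtain ⟨hf, ha', hb'⟩ := exists_isFlag_of_inf R hx ha hb hab hxa hxb
    exact ⟨planeLine hx hf.upper hf.le (sup_le hay hby), ha', hb'⟩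
  choose mkP hmkP using hpt
  choose mkL hmkL using hli
  refine ⟨{ hnd with
    mkPoint := fun {l₁ l₂} h => mkP l₁ l₂ h
    mkPoint_ax := fun {l₁ l₂} h => hmkP l₁ l₂ h
    mkLine := fun {p₁ p₂} h => mkL p₁ p₂ h
    mkLine_ax := fun {p₁ p₂} h => hmkL p₁ p₂ h
    exists_config := ?_ }⟩
  obtain ⟨p₁, hp₁, p₂, hp₂, p₃, hp₃, C₁, C₂, C₃, ⟨a1, a2, a3⟩, ⟨b1, b2, b3⟩, ⟨c1, c2, c3⟩,
    h1, h2, h3, h4, h5, h6, h7, h8⟩ := plane_config R hx hy hxy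
  exact ⟨⟨p₁, hp₁⟩, ⟨p₂, hp₂⟩, ⟨p₃, hp₃⟩, planeLine hx a1 a2 a3, planeLine hx b1 b2 b3,
    planeLine hx c1 c2 c3, fun h => h1 h.2.2, fun h => h2 h.2.2, fun h => h3 h.2.2,
    ⟨hp₂.1, hp₂.2.1, h4⟩, ⟨hp₂.1, hp₂.2.1, h5⟩, fun h => h6 h.2.2, ⟨hp₃.1, hp₃.2.1, h7⟩,
    fun h => h8 h.2.2⟩

/-- A subspace containing two lines of a star plane contains the plane. -/
theorem between_subset_of_two_lines (R : IsRank d n) (hy : d y = k + 2) {C D : α}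
    (hC : IsFlag d k x C) (hD : IsFlag d k x D) (hCy : C ≤ y) (hDy : D ≤ y) (hCD : C ≠ D)
    {Y : Set α} (hY : (grass d k).IsSubspace Y) (hCY : between d k x C ⊆ Y)
    (hDY : between d k x D ⊆ Y) : between d k x y ⊆ Y := by
  rintro q ⟨hq, hxq, hqy⟩
  by_cases hqC : q ≤ C
  · exact hCY ⟨hq, hxq, hqC⟩
  by_cases hqD : q ≤ D
  · exact hDY ⟨hq, hxq, hqD⟩
  -- For `q` off both lines, join it to a point `a` of `C` off `D`; that line meets `D` in a second
  -- point of `Y`.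
  obtain ⟨a, ha, hai⟩ := (hC.nontrivial R).exists_ne (C ⊓ D)
  have hi := rank_inf_of_plane R hy hC.upper hCy hD.upper hDy hCD
  have haD : ¬ a ≤ D := fun h => hai (R.eq_of_le (le_inf ha.2.2 h) (by have := ha.1; omega))
  have haq : a ≠ q := fun h => hqC (h ▸ ha.2.2)
  obtain ⟨hf, ha', hq'⟩ := exists_isFlag_of_inf R hC.lower ha.1 hq haq ha.2.1 hxq
  have hne : a ⊔ q ≠ D := fun h => haD (h ▸ le_sup_left)
  have hb := rank_inf_of_plane R hy hf.upper (sup_le (ha.2.2.trans hCy) hqy) hD.upper hDy hne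
  have hxb := le_inf hf.le hD.le
  exact between_subset_of_mem hY hf ha' ⟨hb, hxb, inf_le_left⟩
    (fun h => haD (h ▸ inf_le_right)) (hCY ha) (hDY ⟨hb, hxb, inf_le_right⟩) hq'

end Plane

/-- Two distinct lines of the fragment through a proper point and with the same lower element are
coplanar and lie in a pencil. -/
theorem coplanar_and_copencil_of_lower (R : IsRank d n) {U C D : α} (hU : U ∈ S)
    (hC : IsFlag d k H C) (hD : IsFlag d k H D) (hCU : U ∈ between d k H C)
    (hDU : U ∈ between d k H D) (hCD : C ≠ D) (hCS : (between d k H C ∩ S).Nontrivial)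
    (hDS : (between d k H D ∩ S).Nontrivial) :
    (grass d k).Coplanar S (between d k H C ∩ S) (between d k H D ∩ S) ∧
      (grass d k).Copencil S (between d k H C ∩ S) (between d k H D ∩ S) := by
  have hy : d (C ⊔ D) = k + 2 := by
    have h1 := R.modular C D
    have h2 := R.mono (le_inf hCU.2.2 hDU.2.2)
    have h3 : d C < d (C ⊔ D) := R.lt_of_le_of_ne le_sup_left fun hc =>
      hCD (R.eq_of_le (by rw [hc]; exact le_sup_right)
        (by have := hC.upper; have := hD.upper; omega)).symm
    have := hC.upper
    have := hD.upper
    have := hCU.1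
    omega
  set y := C ⊔ D
  have hCy : between d k H C ⊆ between d k H y := fun a ha => ⟨ha.1, ha.2.1, ha.2.2.trans le_sup_left⟩
  have hDy : between d k H D ⊆ between d k H y :=
    fun a ha => ⟨ha.1, ha.2.1, ha.2.2.trans le_sup_right⟩
  -- The proper points still span the plane: they contain the traces of two lines, each of which
  -- closes up to its full line.
  have hcl : (grass d k).closure (between d k H y ∩ S) = between d k H y := by
    apply Set.Subset.antisymm
    · exact (isSubspace_between R H y).closure_subset Set.inter_subset_left
    · rintro U hU Y ⟨hY, hYs⟩
      refine between_subset_of_two_lines R hy hC hD le_sup_left le_sup_right hCD hY ?_ ?_ hU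
      · rw [← closure_trace R hC hCS]
        exact hY.closure_subset ((Set.inter_subset_inter_left S hCy).trans hYs)
      · rw [← closure_trace R hD hDS]
        exact hY.closure_subset ((Set.inter_subset_inter_left S hDy).trans hYs)
  have hE : (grass d k).IsFragPlane S (between d k H y ∩ S) := by
    refine ⟨⟨fun a ha => ⟨ha.1.1, ha.2⟩, ?_⟩, ?_⟩
    · rintro L ⟨g, hg, rfl, -⟩ hn
      refine Set.inter_subset_inter_left S ((isSubspace_between R H y).2 g hg (hn.mono ?_))
      exact fun a ha => ⟨ha.1.1, ha.2.1⟩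
    · rw [hcl]
      exact isPlane_between R hC.lower hy (hC.le.trans le_sup_left)
  have hCl := mem_fragment_lines.2 ⟨H, C, hC, rfl, hCS⟩
  have hDl := mem_fragment_lines.2 ⟨H, D, hD, rfl, hDS⟩
  refine ⟨⟨hCl, hDl, _, hE, Set.inter_subset_inter_left S hCy, Set.inter_subset_inter_left S hDy⟩,
    _, U, hE, ⟨hCU.1, hU⟩, hcl.symm.subset (hCy hCU), ⟨hCl, ?_, ?_⟩, ⟨hDl, ?_, ?_⟩⟩
  · rwa [closure_trace R hC hCS]
  · rwa [closure_trace R hC hCS, hcl]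
  · rwa [closure_trace R hD hDS]
  · rwa [closure_trace R hD hDS, hcl]

theorem clique_of_isStrong (R : IsRank d n) {P : Set α} (hP : (grass d k).IsStrong P) {a b : α}
    (ha : a ∈ P) (hb : b ∈ P) (hab : a ≠ b) :
    (∀ u ∈ P, a ⊓ b ≤ u) ∨ ∀ u ∈ P, u ≤ a ⊔ b := by
  refine R.clique (k := k) (fun u hu => hP.1.1 hu) (fun u hu v hv huv => ?_) ha hb hab
  obtain ⟨L, hL, hu, hv⟩ := hP.2 u hu v hv huv
  obtain ⟨H, B, hf, rfl⟩ := mem_grass_lines.1 hL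
  rw [(hf.eq_of_mem R hu hv huv).1, hf.lower]

/-- Two lines of a strong subspace share their lower or upper element. -/
theorem eq_or_eq_of_isStrong (R : IsRank d n) {P : Set α} (hP : (grass d k).IsStrong P)
    (hf : IsFlag d k H B) (hf' : IsFlag d k H' B') (h : between d k H B ⊆ P)
    (h' : between d k H' B' ⊆ P) : H = H' ∨ B = B' := by
  obtain ⟨a, ha, b, hb, hab⟩ := hf.nontrivial R
  obtain ⟨u, hu, v, hv, huv⟩ := hf'.nontrivial R
  obtain ⟨h1, h2⟩ := hf.eq_of_mem R ha hb hab
  obtain ⟨h3, h4⟩ := hf'.eq_of_mem R hu hv huv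
  rcases clique_of_isStrong R hP (h ha) (h hb) hab with hc | hc
  · rw [h1] at hc
    exact Or.inl (R.eq_of_le (h3 ▸ le_inf (hc u (h' hu)) (hc v (h' hv)))
      (by have := hf.lower; have := hf'.lower; omega))
  · rw [h2] at hc
    exact Or.inr (R.eq_of_le (h4 ▸ sup_le (hc u (h' hu)) (hc v (h' hv)))
      (by have := hf.upper; have := hf'.upper; omega)).symm

theorem _root_.PointLine.Coplanar.exists_isStrong {P : Type*} {A : PointLine P} {S L M : Set P}
    (h : A.Coplanar S L M) : ∃ Q, A.IsStrong Q ∧ A.closure L ⊆ Q ∧ A.closure M ⊆ Q := by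
  obtain ⟨-, -, E, hE, hL, hM⟩ := h
  exact ⟨_, hE.2.1, A.closure_mono hL, A.closure_mono hM⟩

theorem _root_.PointLine.Copencil.exists_isStrong {P : Type*} {A : PointLine P} {S L M : Set P}
    (h : A.Copencil S L M) : ∃ Q, A.IsStrong Q ∧ A.closure L ⊆ Q ∧ A.closure M ⊆ Q := by
  obtain ⟨E, U, hE, -, -, hL, hM⟩ := h
  exact ⟨_, hE.2.1, hL.2.2, hM.2.2⟩

/-! ### Dualising the Grassmann space -/

theorem between_dual (R : IsRank d n) (hk : k ≤ n) (x y : α) :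
    (between (α := αᵒᵈ) (fun a : α => n - d a) (n - k) y x : Set α) = between d k x y := by
  ext U
  have h := R.le_top_rank U
  have h' : n - d U = n - k ↔ d U = k := by omega
  exact ⟨fun ⟨h1, h2, h3⟩ => ⟨h'.1 h1, h3, h2⟩, fun ⟨h1, h2, h3⟩ => ⟨h'.2 h1, h3, h2⟩⟩

theorem isFlag_dual (R : IsRank d n) (hk : k < n) (x y : α) :
    IsFlag (α := αᵒᵈ) (fun a : α => n - d a) (n - k) y x ↔ IsFlag d k x y := by
  have h := R.le_top_rank x
  have h' := R.le_top_rank y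
  constructor
  · rintro ⟨h1, h2, h3⟩
    change n - d y + 1 = n - k at h1
    change n - d x = n - k + 1 at h2
    exact ⟨by omega, by omega, h3⟩
  · rintro ⟨h1, h2, h3⟩
    refine ⟨?_, ?_, h3⟩
    · omega
    · omega

/-- An equality, not merely an isomorphism, so statements about the dual can be transported by
rewriting. -/
theorem grass_dual (R : IsRank d n) (hk : k < n) :
    (grass (α := αᵒᵈ) (fun a : α => n - d a) (n - k) : PointLine α) = grass d k := by
  have h1 : (grass (α := αᵒᵈ) (fun a : α => n - d a) (n - k)).points = (grass d k).points := by
    ext U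
    have h := R.le_top_rank U
    change n - d U = n - k ↔ d U = k
    omega
  have h2 : (grass (α := αᵒᵈ) (fun a : α => n - d a) (n - k)).lines = (grass d k).lines := by
    ext g
    refine (mem_grass_lines (α := αᵒᵈ)).trans (Iff.trans ?_ (mem_grass_lines (α := α)).symm)
    constructor
    · rintro ⟨B, H, h, rfl⟩
      exact ⟨H, B, (isFlag_dual R hk H B).1 h, between_dual R hk.le H B⟩
    · rintro ⟨H, B, h, rfl⟩
      exact ⟨B, H, (isFlag_dual R hk H B).2 h, (between_dual R hk.le H B).symm⟩
  change PointLine.mk _ _ = PointLine.mk _ _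
  exact congrArg₂ PointLine.mk h1 h2

theorem coplanar_and_copencil_of_upper (R : IsRank d n) (hk : k < n) {U C D : α} (hU : U ∈ S)
    (hC : IsFlag d k C B) (hD : IsFlag d k D B) (hCU : U ∈ between d k C B)
    (hDU : U ∈ between d k D B) (hCD : C ≠ D) (hCS : (between d k C B ∩ S).Nontrivial)
    (hDS : (between d k D B ∩ S).Nontrivial) :
    (grass d k).Coplanar S (between d k C B ∩ S) (between d k D B ∩ S) ∧
      (grass d k).Copencil S (between d k C B ∩ S) (between d k D B ∩ S) := by
  rw [← between_dual R hk.le] at hCU hDU hCS hDS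
  have h := coplanar_and_copencil_of_lower (α := αᵒᵈ) R.dual (U := U) (S := S) hU
    ((isFlag_dual R hk C B).2 hC) ((isFlag_dual R hk D B).2 hD) hCU hDU hCD hCS hDS
  rwa [grass_dual R hk, between_dual R hk.le, between_dual R hk.le] at h

end Grassmann

end IsRank

/-! ### Spine spaces, their parameters and their duals -/

namespace IsRank

section Spine

variable {α : Type*} [Lattice α] {d : α → ℕ} {n k m : ℕ} {S : Set α} {W : α}
  {H B H' B' U : α} {X : Set α}

/-- Stars of the fragment on `S`. -/
def StarOn (d : α → ℕ) (k : ℕ) (S X : Set α) : Prop :=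
  ∃ H : α, d H + 1 = k ∧ X = {U | U ∈ S ∧ H ≤ U}

/-- Tops of the fragment on `S`. -/
def TopOn (d : α → ℕ) (k : ℕ) (S X : Set α) : Prop :=
  ∃ B : α, d B = k + 1 ∧ X = {U | U ∈ S ∧ U ≤ B}

/-- The proper points of a spine space. -/
def spine (d : α → ℕ) (k m : ℕ) (W : α) : Set α :=
  {U | d U = k ∧ d (U ⊓ W) = m}

/-- `B` and `H` determine a line of the fragment on `S` passing through `U`. -/
structure IsLineAt (d : α → ℕ) (k : ℕ) (S : Set α) (U H B : α) : Prop where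
  flag : IsFlag d k H B
  mem : U ∈ between d k H B
  nontrivial : (between d k H B ∩ S).Nontrivial

theorem isLineAt_of_mem (hL : X ∈ ((grass d k).fragment S).lines) (hU : U ∈ X) :
    ∃ H B, IsLineAt d k S U H B ∧ X = between d k H B ∩ S := by
  obtain ⟨H, B, hf, rfl, hn⟩ := mem_fragment_lines.1 hL
  exact ⟨H, B, ⟨hf, hU.1, hn⟩, rfl⟩

variable [BoundedOrder α]

/-- The numerical assumptions on a spine space. -/
structure SpineParams (d : α → ℕ) (n k m : ℕ) (W : α) : Prop where
  rank : IsRank d n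
  two_le : 2 ≤ k
  add_two_le : k + 2 ≤ n
  le_k : m ≤ k
  le_W : m ≤ d W
  codim : k + d W ≤ m + n
  ne : ¬ (m = k ∧ d W = k)

theorem starOn_dual (R : IsRank d n) (hk : k < n) :
    StarOn (α := αᵒᵈ) (fun a : α => n - d a) (n - k) S X ↔ TopOn d k S X := by
  constructor
  · rintro ⟨B, h, hX⟩
    have h' := R.le_top_rank B
    change n - d B + 1 = n - k at h
    exact ⟨B, by omega, hX⟩
  · rintro ⟨B, h, hX⟩
    refine ⟨B, ?_, hX⟩
    change n - d B + 1 = n - k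
    omega

theorem isLineAt_dual (R : IsRank d n) (hk : k < n) :
    IsLineAt (α := αᵒᵈ) (fun a : α => n - d a) (n - k) S U B H ↔ IsLineAt d k S U H B := by
  constructor
  · rintro ⟨h1, h2, h3⟩
    rw [between_dual R hk.le] at h2 h3
    exact ⟨(isFlag_dual R hk _ _).1 h1, h2, h3⟩
  · rintro ⟨h1, h2, h3⟩
    refine ⟨(isFlag_dual R hk _ _).2 h1, ?_, ?_⟩
    · rwa [between_dual R hk.le]
    · rwa [between_dual R hk.le]

/-- Meeting `W` in rank `m` amounts to joining it in rank `k + d W - m`, whose corank is the dual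
parameter. -/
theorem SpineParams.spine_dual (p : SpineParams d n k m W) :
    (spine (α := αᵒᵈ) (fun a : α => n - d a) (n - k) (n + m - k - d W) W : Set α) =
      spine d k m W := by
  ext U
  have h1 := p.rank.le_top_rank U
  have h2 := p.rank.modular U W
  have h3 := p.rank.le_top_rank (U ⊔ W)
  have h4 := p.rank.mono (inf_le_right : U ⊓ W ≤ W)
  have := p.add_two_le
  have := p.codim
  have h : (n - d U = n - k ∧ n - d (U ⊔ W) = n + m - k - d W) ↔ (d U = k ∧ d (U ⊓ W) = m) := by
    omega
  exact h

theorem SpineParams.dual (p : SpineParams d n k m W) :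
    SpineParams (α := αᵒᵈ) (fun a : α => n - d a) n (n - k) (n + m - k - d W) W := by
  have h := p.rank.le_top_rank W
  obtain ⟨R, h1, h2, h3, h4, h5, h6⟩ := p
  refine ⟨R.dual, ?_, ?_, ?_, ?_, ?_, ?_⟩ <;> omega

theorem SpineParams.lt (p : SpineParams d n k m W) : k < n := by
  have := p.add_two_le
  omega

/-! ### Strong subspaces and semibundles of a fragment -/

section Fragment

theorem isStrong_star (R : IsRank d n) (hS : ∀ U ∈ S, d U = k) (hH : d H + 1 = k) :
    ((grass d k).fragment S).IsStrong {U | U ∈ S ∧ H ≤ U} := by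
  refine ⟨⟨fun U hU => ⟨hS U hU.1, hU.1⟩, ?_⟩, ?_⟩
  · rintro L hL ⟨a, ⟨haL, ha⟩, b, ⟨hbL, hb⟩, hab⟩ U hU
    obtain ⟨H', B, hf, rfl, -⟩ := mem_fragment_lines.1 hL
    obtain ⟨rfl, rfl⟩ := hf.eq_of_mem R haL.1 hbL.1 hab
    exact ⟨hU.2, (le_inf ha.2 hb.2).trans hU.1.2.1⟩
  · rintro a ⟨ha, hHa⟩ b ⟨hb, hHb⟩ hab
    obtain ⟨hf, ha', hb'⟩ := exists_isFlag_of_inf R hH (hS a ha) (hS b hb) hab hHa hHb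
    exact ⟨_, mem_fragment_lines.2 ⟨_, _, hf, rfl, a, ⟨ha', ha⟩, b, ⟨hb', hb⟩, hab⟩,
      ⟨ha', ha⟩, ⟨hb', hb⟩⟩

theorem isStrong_top (R : IsRank d n) (hk : k < n) (hS : ∀ U ∈ S, d U = k) (hB : d B = k + 1) :
    ((grass d k).fragment S).IsStrong {U | U ∈ S ∧ U ≤ B} := by
  have h := isStrong_star (α := αᵒᵈ) R.dual (H := B) (k := n - k) (S := S)
    (fun U hU => by rw [hS U hU]) (by have := R.le_top_rank B; omega)
  rwa [grass_dual R hk] at h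

theorem clique_of_isStrong_fragment (R : IsRank d n) (hX : ((grass d k).fragment S).IsStrong X)
    {a b : α} (ha : a ∈ X) (hb : b ∈ X) (hab : a ≠ b) :
    (∀ u ∈ X, a ⊓ b ≤ u) ∨ ∀ u ∈ X, u ≤ a ⊔ b := by
  refine R.clique (k := k) (fun u hu => (hX.1.1 hu).1) (fun u hu v hv huv => ?_) ha hb hab
  obtain ⟨L, hL, hu, hv⟩ := hX.2 u hu v hv huv
  obtain ⟨H, B, hf, rfl, -⟩ := mem_fragment_lines.1 hL
  rw [(hf.eq_of_mem R hu.1 hv.1 huv).1, hf.lower]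

/-- The clique dichotomy encloses `X` in a star or a top, which is itself strong; maximality gives
equality. -/
theorem starOn_or_topOn (R : IsRank d n) (hk : k < n) (hS : ∀ U ∈ S, d U = k)
    (hX : Maximal ((grass d k).fragment S).IsStrong X) (hn : X.Nontrivial) :
    StarOn d k S X ∨ TopOn d k S X := by
  obtain ⟨a, ha, b, hb, hab⟩ := hn
  obtain ⟨L, hL, haL, hbL⟩ := hX.1.2 a ha b hb hab
  obtain ⟨H, B, hf, rfl, -⟩ := mem_fragment_lines.1 hL
  obtain ⟨rfl, rfl⟩ := hf.eq_of_mem R haL.1 hbL.1 hab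
  rcases clique_of_isStrong_fragment R hX.1 ha hb hab with h | h
  · exact Or.inl ⟨_, hf.lower, hX.eq_of_subset (isStrong_star R hS hf.lower)
      fun u hu => ⟨(hX.1.1.1 hu).2, h u hu⟩⟩
  · exact Or.inr ⟨_, hf.upper, hX.eq_of_subset (isStrong_top R hk hS hf.upper)
      fun u hu => ⟨(hX.1.1.1 hu).2, h u hu⟩⟩

theorem IsLineAt.exists_ne (h : IsLineAt d k S U H B) (R : IsRank d n) :
    ∃ a ∈ S, a ∈ between d k H B ∧ a ≠ U ∧ a ⊓ U = H ∧ a ⊔ U = B := by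
  obtain ⟨a, ha, hne⟩ := h.nontrivial.exists_ne U
  obtain ⟨h1, h2⟩ := h.flag.eq_of_mem R ha.1 h.mem hne
  exact ⟨a, ha.2, ha.1, hne, h1, h2⟩

theorem mem_linesThrough_star (R : IsRank d n) (hH : d H + 1 = k) {L : Set α} :
    L ∈ (grass d k).linesThrough S U {A | A ∈ S ∧ H ≤ A} ↔
      ∃ B, IsLineAt d k S U H B ∧ L = between d k H B ∩ S := by
  constructor
  · rintro ⟨hL, hU, hs⟩
    obtain ⟨H', B, hf, rfl, hn⟩ := mem_fragment_lines.1 hL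
    rw [closure_trace R hf hn] at hU
    have hn' := hn
    obtain ⟨a, ha, b, hb, hab⟩ := hn'
    have h1 := (hf.eq_of_mem R ha.1 hb.1 hab).1
    have h2 : H ≤ H' := h1 ▸ le_inf (hs ha).2 (hs hb).2
    obtain rfl := R.eq_of_le h2 (by have := hf.lower; omega)
    exact ⟨B, ⟨hf, hU, hn⟩, rfl⟩
  · rintro ⟨B, h, rfl⟩
    refine ⟨mem_fragment_lines.2 ⟨H, B, h.flag, rfl, h.nontrivial⟩, ?_,
      fun a ha => ⟨ha.2, ha.1.2.1⟩⟩
    rw [closure_trace R h.flag h.nontrivial]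
    exact h.mem

theorem mem_linesThrough_top (R : IsRank d n) (hk : k < n) (hB : d B = k + 1) {L : Set α} :
    L ∈ (grass d k).linesThrough S U {A | A ∈ S ∧ A ≤ B} ↔
      ∃ H, IsLineAt d k S U H B ∧ L = between d k H B ∩ S := by
  have h := mem_linesThrough_star (α := αᵒᵈ) R.dual (H := B) (k := n - k) (S := S) (U := U)
    (L := L) (by have := R.le_top_rank B; omega)
  rw [grass_dual R hk] at h
  refine h.trans (exists_congr fun H => ?_)
  have e := congrArg (· ∩ S) (between_dual R hk.le H B)
  exact and_congr (isLineAt_dual R hk) ⟨fun h => h.trans e, fun h => h.trans e.symm⟩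

theorem mem_of_isProperVertex_star (R : IsRank d n)
    (h : (grass d k).IsProperVertex S U {A | A ∈ S ∧ H ≤ A}) (hS : ∀ U ∈ S, d U = k) :
    U ∈ S ∧ H ≤ U := by
  refine ⟨h.2.1.2, ?_⟩
  have h1 := (isSubspace_between (k := k) R H ⊤).closure_subset
    (fun a ha => ⟨hS a ha.1, ha.2, le_top⟩) h.2.2
  exact h1.2.1

/-- If two lines of the star with lower element `H` pass through `U`, then the star is a maximal
strong subspace. -/
theorem maximal_star (R : IsRank d n) (hS : ∀ U ∈ S, d U = k) (hU : U ∈ S) {B₁ B₂ : α}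
    (h₁ : IsLineAt d k S U H B₁) (h₂ : IsLineAt d k S U H B₂) (hne : B₁ ≠ B₂) :
    Maximal ((grass d k).fragment S).IsStrong {A | A ∈ S ∧ H ≤ A} := by
  refine ⟨isStrong_star R hS h₁.flag.lower, fun Y hY hXY u hu => ⟨(hY.1.1 hu).2, ?_⟩⟩
  obtain ⟨a, haS, ha, haU, hai, has⟩ := h₁.exists_ne R
  obtain ⟨b, hbS, hb, hbU, hbi, hbs⟩ := h₂.exists_ne R
  rcases clique_of_isStrong_fragment R hY (hXY ⟨haS, ha.2.1⟩) (hXY ⟨hU, h₁.mem.2.1⟩) haU with h | h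
  · exact hai ▸ h u hu
  · rw [has] at h
    refine absurd (R.eq_of_le (hbs ▸ sup_le (h b (hXY ⟨hbS, hb.2.1⟩)) h₁.mem.2.2) ?_).symm hne
    rw [h₁.flag.upper, h₂.flag.upper]

end Fragment

/-! ### Which flags carry spine lines, and which stars are maximal -/

section Lines

/-- Here `H` meets `W` in rank `m` and `B` in rank at most `m + 1`. An improper point contains `B ⊓
W`; two of them would put it inside `H`, so at most one exists. Three points on the line thus yield
a proper one besides `U`. -/
theorem isLineAt_of_inf_le (R : IsRank d n) (hU : U ∈ spine d k m W) (hf : IsFlag d k H B)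
    (hHU : H ≤ U) (hUB : U ≤ B) (h : U ⊓ W ≤ H) : IsLineAt d k (spine d k m W) U H B := by
  have hUm : U ∈ between d k H B := ⟨hU.1, hHU, hUB⟩
  refine ⟨hf, hUm, ?_⟩
  have hHW : d (H ⊓ W) = m := by
    rw [← hU.2]
    exact congrArg d (le_antisymm (inf_le_inf_right W hHU) (le_inf h inf_le_right))
  have hBW : d (B ⊓ W) ≤ m + 1 := by
    have h1 := R.modular B W
    have h2 := R.modular U W
    have h3 := R.mono (sup_le_sup_right hUB W)
    have := hU.1
    have := hU.2
    have := hf.upper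
    omega
  have hlow : ∀ a ∈ between d k H B, m ≤ d (a ⊓ W) := fun a ha =>
    hHW ▸ R.mono (inf_le_inf_right W ha.2.1)
  have hup : ∀ a ∈ between d k H B, d (a ⊓ W) ≠ m → a ⊓ W = B ⊓ W := fun a ha hm =>
    R.eq_of_le (inf_le_inf_right W ha.2.2) (by have := hlow a ha; omega)
  obtain ⟨a, ha, haU⟩ := (hf.nontrivial R).exists_ne U
  by_cases ham : d (a ⊓ W) = m
  · exact ⟨U, ⟨hUm, hU⟩, a, ⟨ha, ha.1, ham⟩, haU.symm⟩
  obtain ⟨hi, hs⟩ := hf.eq_of_mem R ha hUm haU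
  obtain ⟨c, hc, hic, hcs, hca, hcU⟩ := R.third (a := a) (b := U) (by rw [ha.1, hU.1])
    (by rw [hs, ha.1, hf.upper])
  have hc : c ∈ between d k H B := ⟨hc.trans ha.1, hi ▸ hic, hs ▸ hcs⟩
  by_cases hcm : d (c ⊓ W) = m
  · exact ⟨U, ⟨hUm, hU⟩, c, ⟨hc, hc.1, hcm⟩, hcU.symm⟩
  exfalso
  have h1 := hup a ha ham
  have h2 := hup c hc hcm
  have h3 : a ⊓ W ≤ H ⊓ W := by
    refine le_inf ?_ inf_le_right
    rw [← (hf.eq_of_mem R ha hc hca.symm).1]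
    exact le_inf inf_le_left (h1 ▸ h2 ▸ inf_le_left)
  have h4 := R.mono h3
  have h5 := hlow a ha
  omega

theorem isLineAt_of_le_sup (p : SpineParams d n k m W) (hU : U ∈ spine d k m W)
    (hf : IsFlag d k H B) (hHU : H ≤ U) (hUB : U ≤ B) (h : B ≤ U ⊔ W) :
    IsLineAt d k (spine d k m W) U H B := by
  rw [← p.spine_dual] at hU
  have h' := isLineAt_of_inf_le (α := αᵒᵈ) p.rank.dual hU ((isFlag_dual p.rank p.lt H B).2 hf)
    hUB hHU h
  rwa [p.spine_dual, isLineAt_dual p.rank p.lt] at h'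

/-- If `B` is not below `U ⊔ W`, then `B ⊓ W` has rank `m`, so every proper point of the line
contains `U ⊓ W`; a second one meets `U` in `H`. -/
theorem IsLineAt.inf_le_or_le_sup (h : IsLineAt d k (spine d k m W) U H B) (R : IsRank d n)
    (hU : U ∈ spine d k m W) : U ⊓ W ≤ H ∨ B ≤ U ⊔ W := by
  by_contra! hc
  obtain ⟨a, haS, ha, haU, hai, has⟩ := h.exists_ne R
  have h1 : d (U ⊔ W) < d (B ⊔ W) := R.lt_of_le_of_ne (sup_le_sup_right h.mem.2.2 W)
    fun he => hc.2 (he ▸ le_sup_left)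
  have h2 := R.modular B W
  have h3 := R.modular U W
  have h4 : U ⊓ W = B ⊓ W := R.eq_of_le (inf_le_inf_right W h.mem.2.2)
    (by have := h.mem.1; have := h.flag.upper; omega)
  have h5 : a ⊓ W = B ⊓ W := R.eq_of_le (inf_le_inf_right W ha.2.2)
    (by rw [← h4, hU.2, haS.2])
  refine hc.1 ?_
  rw [← hai, h4, ← h5]
  exact le_inf inf_le_left (h5 ▸ h4 ▸ inf_le_left)

/-- In the first case any cover of `U` serves as upper element; in the second, any cover inside `U ⊔
W`, which has rank at least `k + 2`. -/
theorem exists_two_lines (p : SpineParams d n k m W) (hU : U ∈ spine d k m W) (hH : d H + 1 = k)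
    (hHU : H ≤ U) (h : U ⊓ W ≤ H ∨ m + 2 ≤ d W) :
    ∃ B₁ B₂, B₁ ≠ B₂ ∧ IsLineAt d k (spine d k m W) U H B₁ ∧
      IsLineAt d k (spine d k m W) U H B₂ := by
  rcases h with h | h
  · obtain ⟨b, c, hbc, h1, h2, h3, h4, h5, h6⟩ := p.rank.exists_two_covers (le_top : U ≤ ⊤)
      (by rw [p.rank.top, hU.1]; exact p.add_two_le)
    rw [hU.1] at h3 h6
    exact ⟨b, c, hbc, isLineAt_of_inf_le p.rank hU ⟨hH, h3, hHU.trans h1⟩ hHU h1 h,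
      isLineAt_of_inf_le p.rank hU ⟨hH, h6, hHU.trans h4⟩ hHU h4 h⟩
  · have hm := p.rank.modular U W
    have hU1 := hU.1
    have hU2 := hU.2
    obtain ⟨b, c, hbc, h1, h2, h3, h4, h5, h6⟩ :=
      p.rank.exists_two_covers (le_sup_left : U ≤ U ⊔ W) (by omega)
    rw [hU.1] at h3 h6
    exact ⟨b, c, hbc, isLineAt_of_le_sup p hU ⟨hH, h3, hHU.trans h1⟩ hHU h1 h2,
      isLineAt_of_le_sup p hU ⟨hH, h6, hHU.trans h4⟩ hHU h4 h5⟩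

/-- If the star with lower element `H` has at most one line through `U`, then some other line through
`U` has an upper element containing that star. -/
theorem exists_isLineAt_not_le (p : SpineParams d n k m W) (hU : U ∈ spine d k m W)
    (hHU : H ≤ U) (hd : d W ≤ m + 1) (hH : d H + 1 = k)
    (h : ¬ U ⊓ W ≤ H) :
    ∃ H' B, H' ≠ H ∧ IsLineAt d k (spine d k m W) U H' B ∧ U ⊔ W ≤ B := by
  have hm := p.rank.modular U W
  have hU1 := hU.1
  have hU2 := hU.2
  have h2 := p.two_le
  have h3 := p.add_two_le
  have h4 := p.le_W
  obtain ⟨B, hUB, -, hB⟩ := p.rank.chain (j := k + 1) (le_top : U ⊔ W ≤ ⊤) (by omega)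
    (by rw [p.rank.top]; omega)
  -- If `d W = m`, the excluded one-point case leaves room for an `H'` containing `U ⊓ W`. If `d W =
  -- m + 1`, then `B = U ⊔ W` and any `H' ≠ H` works; one through a complement of `H` in `U` is
  -- chosen.
  by_cases hdW : d W = m
  · have h5 : m < k := by
      have := p.le_k
      have := p.ne
      omega
    obtain ⟨H', h6, h7, h8⟩ := p.rank.chain (j := k - 1) (inf_le_left : U ⊓ W ≤ U) (by omega)
      (by omega)
    refine ⟨H', B, fun he => h (he ▸ h6), isLineAt_of_inf_le p.rank hU
      ⟨by omega, hB, h7.trans (le_sup_left.trans hUB)⟩ h7 (le_sup_left.trans hUB) h6, hUB⟩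
  · obtain ⟨c, h5, h6⟩ := p.rank.compl (bot_le : ⊥ ≤ H) hHU
    have h7 := p.rank.modular H c
    rw [h5, h6, p.rank.bot] at h7
    have hcU : c ≤ U := h6 ▸ le_sup_right
    obtain ⟨H', h8, h9, h10⟩ := p.rank.chain (j := k - 1) hcU (by omega) (by omega)
    refine ⟨H', B, ?_, isLineAt_of_le_sup p hU ⟨by omega, hB, h9.trans (le_sup_left.trans hUB)⟩ h9
      (le_sup_left.trans hUB) (p.rank.eq_of_le hUB (by omega)).ge, hUB⟩
    rintro rfl
    rw [sup_eq_left.2 h8] at h6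
    rw [h6] at h10
    omega

/-- Otherwise all lines of the star through `U` have upper element below `U ⊔ W`, so the star sits
inside a top; that top has a point not above `H`, contradicting maximality. -/
theorem inf_le_or_of_maximal (p : SpineParams d n k m W) (hU : U ∈ spine d k m W)
    (hH : d H + 1 = k) (hHU : H ≤ U)
    (hX : Maximal ((grass d k).fragment (spine d k m W)).IsStrong
      {A | A ∈ spine d k m W ∧ H ≤ A}) : U ⊓ W ≤ H ∨ m + 2 ≤ d W := by
  by_contra! hc
  obtain ⟨H', B, hne, hl, hB⟩ := exists_isLineAt_not_le p hU hHU (by omega) hH hc.1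
  have hXB : {A | A ∈ spine d k m W ∧ H ≤ A} ⊆ {A | A ∈ spine d k m W ∧ A ≤ B} := by
    rintro A ⟨hA, hHA⟩
    refine ⟨hA, ?_⟩
    by_cases hAU : A = U
    · exact hAU ▸ hl.mem.2.2
    obtain ⟨hf, hA', hU'⟩ := exists_isFlag_of_inf p.rank hH hA.1 hU.1 hAU hHA hHU
    have hlA : IsLineAt d k (spine d k m W) U H (A ⊔ U) :=
      ⟨hf, hU', A, ⟨hA', hA⟩, U, ⟨hU', hU⟩, hAU⟩
    exact le_sup_left.trans (((hlA.inf_le_or_le_sup p.rank hU).resolve_left hc.1).trans hB)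
  have he := hX.eq_of_subset (isStrong_top p.rank p.lt (fun U hU => hU.1) hl.flag.upper) hXB
  obtain ⟨a, haS, ha, haU, hai, -⟩ := hl.exists_ne p.rank
  have haX : a ∈ {A | A ∈ spine d k m W ∧ H ≤ A} := he.symm.subset ⟨haS, ha.2.2⟩
  refine hne (p.rank.eq_of_le (hai ▸ le_inf haX.2 hHU) ?_).symm
  have := hl.flag.lower
  omega

theorem exists_isLineAt (p : SpineParams d n k m W) (hU : U ∈ spine d k m W) :
    ∃ H B, IsLineAt d k (spine d k m W) U H B := by
  have hU1 := hU.1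
  have hU2 := hU.2
  have h2 := p.two_le
  have h3 := p.le_k
  have h4 := p.le_W
  by_cases hmk : m < k
  · obtain ⟨H, h5, h6, h7⟩ := p.rank.chain (j := k - 1) (inf_le_left : U ⊓ W ≤ U) (by omega)
      (by omega)
    obtain ⟨B, _, -, hl, -⟩ := exists_two_lines p hU (by omega) h6 (Or.inl h5)
    exact ⟨H, B, hl⟩
  · have h5 := p.ne
    have hm := p.rank.modular U W
    obtain ⟨H, -, h6, h7⟩ := p.rank.chain (j := k - 1) (bot_le : ⊥ ≤ U) (by rw [p.rank.bot]; omega)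
      (by omega)
    obtain ⟨B, h8, h9, h10⟩ := p.rank.chain (j := k + 1) (le_sup_left : U ≤ U ⊔ W) (by omega)
      (by omega)
    exact ⟨H, B, isLineAt_of_le_sup p hU ⟨by omega, h10, h6.trans h8⟩ h6 h8 h9⟩

/-- Only degenerate `X` must be excluded: the empty set has empty closure and hence no vertex, and a
single point lies on a line, hence in a larger star. -/
theorem starOn_or_topOn_spine (p : SpineParams d n k m W)
    (hX : (grass d k).IsProperVertex (spine d k m W) U X) :
    StarOn d k (spine d k m W) X ∨ TopOn d k (spine d k m W) X := by
  refine starOn_or_topOn p.rank p.lt (fun U hU => hU.1) hX.1 ?_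
  by_contra hn
  rw [Set.not_nontrivial_iff] at hn
  have hsub : ∀ A ∈ X, X = {A} := fun A hA => hn.eq_singleton_of_mem hA
  have hne : X.Nonempty := by
    by_contra he
    rw [Set.not_nonempty_iff_eq_empty] at he
    have h := hX.2.2
    rw [he] at h
    exact h ∅ ⟨⟨Set.empty_subset _, fun L _ h => by simp at h⟩, Set.empty_subset _⟩
  obtain ⟨A, hA⟩ := hne
  have hAS : A ∈ spine d k m W := (hX.1.1.1.1 hA).2
  obtain ⟨H, B, hl⟩ := exists_isLineAt p hAS
  have hsubset : X ⊆ {A | A ∈ spine d k m W ∧ H ≤ A} := by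
    rw [hsub A hA, Set.singleton_subset_iff]
    exact ⟨hAS, hl.mem.2.1⟩
  have he := hX.1.eq_of_subset (isStrong_star p.rank (fun U hU => hU.1) hl.flag.lower) hsubset
  obtain ⟨a, haS, ha, haA, -⟩ := hl.exists_ne p.rank
  exact haA (hn (he.symm.subset ⟨haS, ha.2.1⟩) hA)

end Lines

end Spine

end IsRank

/-! ### Related semibundles -/

theorem UpsilonEmpty.symm {P : Type*} {δ : Set P → Set P → Prop} {K₁ K₂ : Set (Set P)}
    (h : UpsilonEmpty δ K₁ K₂) : UpsilonEmpty δ K₂ K₁ :=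
  ⟨h.2.1, h.1, h.2.2.imp (fun h => by rw [Set.inter_comm, h]) Eq.symm⟩

namespace IsRank

section Semibundles

variable {α : Type*} [Lattice α] [BoundedOrder α] {d : α → ℕ} {n k m : ℕ} {S : Set α} {W : α}
  {H B H' B' U U₁ U₂ : α} {X X₁ X₂ : Set α} {δ : Set α → Set α → Prop}

/-- Related lines share their lower or upper element. -/
theorem lower_eq_or_upper_eq (R : IsRank d n)
    (hδ : δ = (grass d k).Coplanar S ∨ δ = (grass d k).Copencil S)
    (h : IsLineAt d k S U₁ H B) (h' : IsLineAt d k S U₂ H' B')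
    (hr : δ (between d k H B ∩ S) (between d k H' B' ∩ S)) : H = H' ∨ B = B' := by
  obtain ⟨Q, hQ, hL, hM⟩ : ∃ Q, (grass d k).IsStrong Q ∧
      (grass d k).closure (between d k H B ∩ S) ⊆ Q ∧
      (grass d k).closure (between d k H' B' ∩ S) ⊆ Q := by
    rcases hδ with rfl | rfl
    · exact PointLine.Coplanar.exists_isStrong hr
    · exact PointLine.Copencil.exists_isStrong hr
  rw [closure_trace R h.flag h.nontrivial] at hL
  rw [closure_trace R h'.flag h'.nontrivial] at hM
  exact eq_or_eq_of_isStrong R hQ h.flag h'.flag hL hM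

theorem rel_of_lower (R : IsRank d n)
    (hδ : δ = (grass d k).Coplanar S ∨ δ = (grass d k).Copencil S) (hU : U ∈ S)
    (h : IsLineAt d k S U H B) (h' : IsLineAt d k S U H B') (hne : B ≠ B') :
    δ (between d k H B ∩ S) (between d k H B' ∩ S) := by
  have hc := coplanar_and_copencil_of_lower R hU h.flag h'.flag h.mem h'.mem hne h.nontrivial
    h'.nontrivial
  rcases hδ with rfl | rfl
  exacts [hc.1, hc.2]

theorem rel_of_upper (R : IsRank d n) (hk : k < n)
    (hδ : δ = (grass d k).Coplanar S ∨ δ = (grass d k).Copencil S) (hU : U ∈ S)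
    (h : IsLineAt d k S U H B) (h' : IsLineAt d k S U H' B) (hne : H ≠ H') :
    δ (between d k H B ∩ S) (between d k H' B ∩ S) := by
  have hc := coplanar_and_copencil_of_upper R hk hU h.flag h'.flag h.mem h'.mem hne h.nontrivial
    h'.nontrivial
  rcases hδ with rfl | rfl
  exacts [hc.1, hc.2]

theorem IsLineAt.between_ne (R : IsRank d n) (h : IsLineAt d k S U H B)
    (h' : IsLineAt d k S U H B') (hne : B ≠ B') :
    between d k H B ∩ S ≠ between d k H B' ∩ S := by
  intro he
  have h1 := closure_trace R h.flag h.nontrivial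
  rw [he, closure_trace R h'.flag h'.nontrivial] at h1
  refine hne (h.flag.eq_of_nontrivial_inter h'.flag R ?_).2
  rw [h1, Set.inter_self]
  exact h.flag.nontrivial R

/-- The upper elements of some two lines of one star semibundle are available in any other star
semibundle with the same vertex. -/
theorem exists_two_common_covers (p : SpineParams d n k m W) (hU : U ∈ spine d k m W)
    (hH : d H + 1 = k) (hH' : d H' + 1 = k) (hHU : H ≤ U) (hHU' : H' ≤ U)
    (h : U ⊓ W ≤ H ∨ m + 2 ≤ d W) (h' : U ⊓ W ≤ H' ∨ m + 2 ≤ d W) :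
    ∃ B₁ B₂, B₁ ≠ B₂ ∧ IsLineAt d k (spine d k m W) U H B₁ ∧
      IsLineAt d k (spine d k m W) U H B₂ ∧ IsLineAt d k (spine d k m W) U H' B₁ ∧
      IsLineAt d k (spine d k m W) U H' B₂ := by
  -- If `U ⊓ W ≤ H`, every upper element used with `H'` also works with `H`; otherwise those of `H`
  -- lie below `U ⊔ W` and so work with `H'`.
  by_cases hg : U ⊓ W ≤ H
  · obtain ⟨B₁, B₂, hne, h₁, h₂⟩ := exists_two_lines p hU hH' hHU' h'
    exact ⟨B₁, B₂, hne,
      isLineAt_of_inf_le p.rank hU ⟨hH, h₁.flag.upper, hHU.trans h₁.mem.2.2⟩ hHU h₁.mem.2.2 hg,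
      isLineAt_of_inf_le p.rank hU ⟨hH, h₂.flag.upper, hHU.trans h₂.mem.2.2⟩ hHU h₂.mem.2.2 hg,
      h₁, h₂⟩
  · obtain ⟨B₁, B₂, hne, h₁, h₂⟩ := exists_two_lines p hU hH hHU h
    have g₁ := (h₁.inf_le_or_le_sup p.rank hU).resolve_left hg
    have g₂ := (h₂.inf_le_or_le_sup p.rank hU).resolve_left hg
    exact ⟨B₁, B₂, hne, h₁, h₂,
      isLineAt_of_le_sup p hU ⟨hH', h₁.flag.upper, hHU'.trans h₁.mem.2.2⟩ hHU' h₁.mem.2.2 g₁,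
      isLineAt_of_le_sup p hU ⟨hH', h₂.flag.upper, hHU'.trans h₂.mem.2.2⟩ hHU' h₂.mem.2.2 g₂⟩

theorem upsilonEmpty_of_starOn (p : SpineParams d n k m W)
    (hδ : δ = (grass d k).Coplanar (spine d k m W) ∨ δ = (grass d k).Copencil (spine d k m W))
    (hX₁ : (grass d k).IsProperVertex (spine d k m W) U X₁)
    (hX₂ : (grass d k).IsProperVertex (spine d k m W) U X₂)
    (h₁ : StarOn d k (spine d k m W) X₁) (h₂ : StarOn d k (spine d k m W) X₂) :
    UpsilonEmpty δ ((grass d k).linesThrough (spine d k m W) U X₁)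
      ((grass d k).linesThrough (spine d k m W) U X₂) := by
  obtain ⟨H, hH, rfl⟩ := h₁
  obtain ⟨H', hH', rfl⟩ := h₂
  obtain ⟨hU, hHU⟩ := mem_of_isProperVertex_star p.rank hX₁ fun U hU => hU.1
  obtain ⟨-, hHU'⟩ := mem_of_isProperVertex_star p.rank hX₂ fun U hU => hU.1
  obtain ⟨B₁, B₂, hne, g₁, g₂, g₁', g₂'⟩ := exists_two_common_covers p hU hH hH' hHU hHU'
    (inf_le_or_of_maximal p hU hH hHU hX₁.1) (inf_le_or_of_maximal p hU hH' hHU' hX₂.1)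
  have mem : ∀ {G C}, d G + 1 = k → IsLineAt d k (spine d k m W) U G C →
      between d k G C ∩ spine d k m W ∈
        (grass d k).linesThrough (spine d k m W) U {A | A ∈ spine d k m W ∧ G ≤ A} :=
    fun hG h => (mem_linesThrough_star p.rank hG).2 ⟨_, h, rfl⟩
  by_cases he : H = H'
  · subst he
    -- The two lines are paired crosswise, since relatedness is available for distinct lines.
    have r₁ := rel_of_lower p.rank hδ hU g₁ g₂ hne
    have r₂ := rel_of_lower p.rank hδ hU g₂ g₁ hne.symm
    have hu : Upsilon δ ((grass d k).linesThrough (spine d k m W) U {A | A ∈ spine d k m W ∧ H ≤ A})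
        ((grass d k).linesThrough (spine d k m W) U {A | A ∈ spine d k m W ∧ H ≤ A}) :=
      ⟨_, mem hH g₁, _, mem hH g₂, _, mem hH g₂, _, mem hH g₁, g₁.between_ne p.rank g₂ hne, r₁, r₂⟩
    exact ⟨hu, hu, Or.inr rfl⟩
  · refine ⟨⟨_, mem hH g₁, _, mem hH g₂, _, mem hH' g₁', _, mem hH' g₂',
        g₁.between_ne p.rank g₂ hne, rel_of_upper p.rank p.lt hδ hU g₁ g₁' he,
        rel_of_upper p.rank p.lt hδ hU g₂ g₂' he⟩,
      ⟨_, mem hH' g₁', _, mem hH' g₂', _, mem hH g₁, _, mem hH g₂,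
        g₁'.between_ne p.rank g₂' hne, rel_of_upper p.rank p.lt hδ hU g₁' g₁ (Ne.symm he),
        rel_of_upper p.rank p.lt hδ hU g₂' g₂ (Ne.symm he)⟩, Or.inl ?_⟩
    rw [Set.eq_empty_iff_forall_notMem]
    rintro L ⟨hL, hL'⟩
    obtain ⟨C, hC, rfl⟩ := (mem_linesThrough_star p.rank hH).1 hL
    obtain ⟨C', hC', hCC⟩ := (mem_linesThrough_star p.rank hH').1 hL'
    refine he (hC.flag.eq_of_nontrivial_inter hC'.flag p.rank (hC.nontrivial.mono ?_)).1
    exact fun a ha => ⟨ha.1, (hCC.subset ha).1⟩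

/-- For `H ≠ H'`, relatedness forces common upper elements `B₁ ≠ B₂`, whose meet is either vertex.
For `H = H'`, the line joining distinct vertices is shared, so the semibundles coincide and contain
only that line, against `L₁ ≠ L₂`. -/
theorem vertex_eq_of_upsilonEmpty (p : SpineParams d n k m W)
    (hδ : δ = (grass d k).Coplanar (spine d k m W) ∨ δ = (grass d k).Copencil (spine d k m W))
    (hX₁ : (grass d k).IsProperVertex (spine d k m W) U₁ X₁)
    (hX₂ : (grass d k).IsProperVertex (spine d k m W) U₂ X₂)
    (h₁ : StarOn d k (spine d k m W) X₁) (h₂ : StarOn d k (spine d k m W) X₂)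
    (hu : UpsilonEmpty δ ((grass d k).linesThrough (spine d k m W) U₁ X₁)
      ((grass d k).linesThrough (spine d k m W) U₂ X₂)) : U₁ = U₂ := by
  obtain ⟨H, hH, rfl⟩ := h₁
  obtain ⟨H', hH', rfl⟩ := h₂
  obtain ⟨hU, hHU⟩ := mem_of_isProperVertex_star p.rank hX₁ fun U hU => hU.1
  obtain ⟨hU', hHU'⟩ := mem_of_isProperVertex_star p.rank hX₂ fun U hU => hU.1
  obtain ⟨⟨L₁, hL₁, L₂, hL₂, M₁, hM₁, M₂, hM₂, hne, r₁, r₂⟩, -, hK⟩ := hu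
  obtain ⟨B₁, g₁, rfl⟩ := (mem_linesThrough_star p.rank hH).1 hL₁
  obtain ⟨B₂, g₂, rfl⟩ := (mem_linesThrough_star p.rank hH).1 hL₂
  have hB : B₁ ≠ B₂ := by
    rintro rfl
    exact hne rfl
  by_contra hUU
  by_cases he : H = H'
  · subst he
    obtain ⟨hf, hm, hm'⟩ := exists_isFlag_of_inf p.rank hH hU.1 hU'.1 hUU hHU hHU'
    have hn : (between d k H (U₁ ⊔ U₂) ∩ spine d k m W).Nontrivial :=
      ⟨U₁, ⟨hm, hU⟩, U₂, ⟨hm', hU'⟩, hUU⟩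
    have hK := hK.resolve_left fun h0 => Set.notMem_empty _ (h0.subset
      ⟨(mem_linesThrough_star p.rank hH).2 ⟨_, ⟨hf, hm, hn⟩, rfl⟩,
        (mem_linesThrough_star p.rank hH).2 ⟨_, ⟨hf, hm', hn⟩, rfl⟩⟩)
    have key : ∀ {C}, IsLineAt d k (spine d k m W) U₁ H C → U₁ ⊔ U₂ = C := by
      intro C hC
      obtain ⟨C', hC', hCC⟩ := (mem_linesThrough_star p.rank hH).1
        (hK.subset ((mem_linesThrough_star p.rank hH).2 ⟨C, hC, rfl⟩))
      have hU₂ : U₂ ∈ between d k H C ∩ spine d k m W := hCC.symm.subset ⟨hC'.mem, hU'⟩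
      exact (hC.flag.eq_of_mem p.rank hC.mem hU₂.1 hUU).2
    exact hB ((key g₁).symm.trans (key g₂))
  · obtain ⟨C₁, f₁, rfl⟩ := (mem_linesThrough_star p.rank hH').1 hM₁
    obtain ⟨C₂, f₂, rfl⟩ := (mem_linesThrough_star p.rank hH').1 hM₂
    obtain rfl := (lower_eq_or_upper_eq p.rank hδ g₁ f₁ r₁).resolve_left he
    obtain rfl := (lower_eq_or_upper_eq p.rank hδ g₂ f₂ r₂).resolve_left he
    have hi : d (B₁ ⊓ B₂) < d B₁ := p.rank.lt_of_le_of_ne inf_le_left fun h =>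
      hB (p.rank.eq_of_le (inf_eq_left.1 h) (by rw [g₁.flag.upper, g₂.flag.upper]))
    have hB₁ := g₁.flag.upper
    have hle : ∀ {A}, d A = k → A ≤ B₁ → A ≤ B₂ → A = B₁ ⊓ B₂ := fun hA h h' =>
      p.rank.eq_of_le (le_inf h h') (by omega)
    exact hUU ((hle hU.1 g₁.mem.2.2 g₂.mem.2.2).trans (hle hU'.1 f₁.mem.2.2 f₂.mem.2.2).symm)

/-- Each direction of `Υ` offers two distinct lines, and one of them must meet its partner's type in
the flag `(H, B)`. This puts that line in both semibundles; equality would then leave the star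
semibundle with one line. -/
theorem not_upsilonEmpty_of_starOn_topOn (p : SpineParams d n k m W)
    (hδ : δ = (grass d k).Coplanar (spine d k m W) ∨ δ = (grass d k).Copencil (spine d k m W))
    (h₁ : StarOn d k (spine d k m W) X₁) (h₂ : TopOn d k (spine d k m W) X₂) :
    ¬ UpsilonEmpty δ ((grass d k).linesThrough (spine d k m W) U₁ X₁)
      ((grass d k).linesThrough (spine d k m W) U₂ X₂) := by
  obtain ⟨H, hH, rfl⟩ := h₁
  obtain ⟨B, hB, rfl⟩ := h₂
  rintro ⟨⟨L₁, hL₁, L₂, hL₂, M₁, hM₁, M₂, hM₂, hne, r₁, r₂⟩,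
    ⟨N₁, hN₁, N₂, hN₂, O₁, hO₁, O₂, hO₂, hne', s₁, s₂⟩, hK⟩
  have star := fun {L} => (mem_linesThrough_star (S := spine d k m W) (U := U₁) p.rank hH (L := L))
  have top := fun {L} =>
    (mem_linesThrough_top (S := spine d k m W) (U := U₂) p.rank p.lt hB (L := L))
  have h1 : IsLineAt d k (spine d k m W) U₂ H B := by
    obtain ⟨B₁, g₁, rfl⟩ := star.1 hL₁
    obtain ⟨B₂, g₂, rfl⟩ := star.1 hL₂
    obtain ⟨H₁, f₁, rfl⟩ := top.1 hM₁
    obtain ⟨H₂, f₂, rfl⟩ := top.1 hM₂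
    rcases lower_eq_or_upper_eq p.rank hδ g₁ f₁ r₁ with h | h
    · exact h ▸ f₁
    rcases lower_eq_or_upper_eq p.rank hδ g₂ f₂ r₂ with h' | h'
    · exact h' ▸ f₂
    exact absurd (by rw [h, h']) hne
  have h2 : IsLineAt d k (spine d k m W) U₁ H B := by
    obtain ⟨H₁, f₁, rfl⟩ := top.1 hN₁
    obtain ⟨H₂, f₂, rfl⟩ := top.1 hN₂
    obtain ⟨B₁, g₁, rfl⟩ := star.1 hO₁
    obtain ⟨B₂, g₂, rfl⟩ := star.1 hO₂
    rcases lower_eq_or_upper_eq p.rank hδ f₁ g₁ s₁ with h | h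
    · rcases lower_eq_or_upper_eq p.rank hδ f₂ g₂ s₂ with h' | h'
      · exact absurd (by rw [h, h']) hne'
      · exact h' ▸ g₂
    · exact h ▸ g₁
  have hKe := hK.resolve_left fun h0 => Set.notMem_empty _ (h0.subset
    ⟨star.2 ⟨B, h2, rfl⟩, top.2 ⟨H, h1, rfl⟩⟩)
  have key : ∀ {L}, L ∈ (grass d k).linesThrough (spine d k m W) U₁
      {A | A ∈ spine d k m W ∧ H ≤ A} → L = between d k H B ∩ spine d k m W := by
    intro L hL
    obtain ⟨C, g, rfl⟩ := star.1 hL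
    obtain ⟨G, f, hGC⟩ := top.1 (hKe.subset hL)
    have h3 := (g.flag.eq_of_nontrivial_inter f.flag p.rank
      (g.nontrivial.mono fun a ha => ⟨ha.1, (hGC.subset ha).1⟩)).2
    rw [h3]
  exact hne ((key hL₁).trans (key hL₂).symm)

/-- The union of the semibundles related to a given star semibundle, over a family containing all
proper star semibundles. -/
theorem upsilonUnion_of_starOn (p : SpineParams d n k m W) (hW : d W ≠ m + 1)
    (hδ : δ = (grass d k).Coplanar (spine d k m W) ∨ δ = (grass d k).Copencil (spine d k m W))
    (hX : Maximal ((grass d k).fragment (spine d k m W)).IsStrong X) (hUX : U ∈ X)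
    (hs : StarOn d k (spine d k m W) X) {𝓑 : Set (Set (Set α))}
    (h𝓑 : ∀ K ∈ 𝓑, ∃ U X, (grass d k).IsProperVertex (spine d k m W) U X ∧
      K = (grass d k).linesThrough (spine d k m W) U X)
    (h𝓑' : ∀ U X, (grass d k).IsProperVertex (spine d k m W) U X →
      StarOn d k (spine d k m W) X → (grass d k).linesThrough (spine d k m W) U X ∈ 𝓑) :
    upsilonUnion δ 𝓑 ((grass d k).linesThrough (spine d k m W) U X) =
      {L | L ∈ ((grass d k).fragment (spine d k m W)).lines ∧ U ∈ L} := by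
  have hU : U ∈ spine d k m W := (hX.1.1.1 hUX).2
  have hpX : (grass d k).IsProperVertex (spine d k m W) U X :=
    ⟨hX, hX.1.1.1 hUX, PointLine.subset_closure _ _ hUX⟩
  ext L
  constructor
  · rintro ⟨K, ⟨hK, hu⟩, hL⟩
    obtain ⟨U', X', hX', rfl⟩ := h𝓑 K hK
    rcases starOn_or_topOn_spine p hX' with hs' | ht'
    · obtain rfl := vertex_eq_of_upsilonEmpty p hδ hpX hX' hs hs' hu
      obtain ⟨H, B, hf, rfl, hn⟩ := mem_fragment_lines.1 hL.1
      refine ⟨hL.1, ?_, hU⟩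
      rw [← closure_trace p.rank hf hn]
      exact hL.2.1
    · exact absurd hu (not_upsilonEmpty_of_starOn_topOn p hδ hs ht')
  · rintro ⟨hL, hUL⟩
    obtain ⟨H, B, hl, rfl⟩ := isLineAt_of_mem hL hUL
    have hH := hl.flag.lower
    -- From `B ≤ U ⊔ W` comes only `d W ≥ m + 1`; excluding equality gives the two lines through `U`
    -- that make the star maximal.
    have hc : U ⊓ W ≤ H ∨ m + 2 ≤ d W := by
      refine (hl.inf_le_or_le_sup p.rank hU).imp_right fun h => ?_
      have h1 := p.rank.mono h
      have h2 := p.rank.modular U W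
      have h3 := hU.1
      have h4 := hU.2
      have h5 := hl.flag.upper
      omega
    obtain ⟨B₁, B₂, hne, g₁, g₂⟩ := exists_two_lines p hU hH hl.mem.2.1 hc
    have hm := maximal_star p.rank (fun U hU => hU.1) hU g₁ g₂ hne
    have hp : (grass d k).IsProperVertex (spine d k m W) U {A | A ∈ spine d k m W ∧ H ≤ A} :=
      ⟨hm, hX.1.1.1 hUX, PointLine.subset_closure _ _ ⟨hU, hl.mem.2.1⟩⟩
    have hs' : StarOn d k (spine d k m W) {A | A ∈ spine d k m W ∧ H ≤ A} := ⟨H, hH, rfl⟩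
    exact ⟨_, ⟨h𝓑' _ _ hp hs', upsilonEmpty_of_starOn p hδ hpX hp hs hs'⟩,
      (mem_linesThrough_star p.rank hH).2 ⟨B, hl, rfl⟩⟩

/-! ### Tops, by order duality -/

section Dual

theorem upsilonEmpty_of_topOn (p : SpineParams d n k m W)
    (hδ : δ = (grass d k).Coplanar (spine d k m W) ∨ δ = (grass d k).Copencil (spine d k m W))
    (hX₁ : (grass d k).IsProperVertex (spine d k m W) U X₁)
    (hX₂ : (grass d k).IsProperVertex (spine d k m W) U X₂)
    (h₁ : TopOn d k (spine d k m W) X₁) (h₂ : TopOn d k (spine d k m W) X₂) :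
    UpsilonEmpty δ ((grass d k).linesThrough (spine d k m W) U X₁)
      ((grass d k).linesThrough (spine d k m W) U X₂) := by
  have h := upsilonEmpty_of_starOn (α := αᵒᵈ) p.dual (δ := δ) (U := U) (X₁ := X₁) (X₂ := X₂)
  rw [grass_dual p.rank p.lt, p.spine_dual] at h
  exact h hδ hX₁ hX₂ ((starOn_dual p.rank p.lt).2 h₁) ((starOn_dual p.rank p.lt).2 h₂)

theorem vertex_eq_of_upsilonEmpty_topOn (p : SpineParams d n k m W)
    (hδ : δ = (grass d k).Coplanar (spine d k m W) ∨ δ = (grass d k).Copencil (spine d k m W))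
    (hX₁ : (grass d k).IsProperVertex (spine d k m W) U₁ X₁)
    (hX₂ : (grass d k).IsProperVertex (spine d k m W) U₂ X₂)
    (h₁ : TopOn d k (spine d k m W) X₁) (h₂ : TopOn d k (spine d k m W) X₂)
    (hu : UpsilonEmpty δ ((grass d k).linesThrough (spine d k m W) U₁ X₁)
      ((grass d k).linesThrough (spine d k m W) U₂ X₂)) : U₁ = U₂ := by
  have h := vertex_eq_of_upsilonEmpty (α := αᵒᵈ) p.dual (δ := δ) (U₁ := U₁) (U₂ := U₂)
    (X₁ := X₁) (X₂ := X₂)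
  rw [grass_dual p.rank p.lt, p.spine_dual] at h
  exact h hδ hX₁ hX₂ ((starOn_dual p.rank p.lt).2 h₁) ((starOn_dual p.rank p.lt).2 h₂) hu

theorem upsilonUnion_of_topOn (p : SpineParams d n k m W) (hkm : k ≠ m + 1)
    (hδ : δ = (grass d k).Coplanar (spine d k m W) ∨ δ = (grass d k).Copencil (spine d k m W))
    (hX : Maximal ((grass d k).fragment (spine d k m W)).IsStrong X) (hUX : U ∈ X)
    (hs : TopOn d k (spine d k m W) X) {𝓑 : Set (Set (Set α))}
    (h𝓑 : ∀ K ∈ 𝓑, ∃ U X, (grass d k).IsProperVertex (spine d k m W) U X ∧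
      K = (grass d k).linesThrough (spine d k m W) U X)
    (h𝓑' : ∀ U X, (grass d k).IsProperVertex (spine d k m W) U X →
      TopOn d k (spine d k m W) X → (grass d k).linesThrough (spine d k m W) U X ∈ 𝓑) :
    upsilonUnion δ 𝓑 ((grass d k).linesThrough (spine d k m W) U X) =
      {L | L ∈ ((grass d k).fragment (spine d k m W)).lines ∧ U ∈ L} := by
  -- Under the dual parameters, `d W ≠ m + 1` becomes `k ≠ m + 1`.
  have h := upsilonUnion_of_starOn (α := αᵒᵈ) p.dual (δ := δ) (U := U) (X := X) (𝓑 := 𝓑) (by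
    have := p.rank.le_top_rank W
    have := p.codim
    have := p.add_two_le
    change n - d W ≠ n + m - k - d W + 1
    omega)
  rw [grass_dual p.rank p.lt, p.spine_dual] at h
  exact h hδ hX hUX ((starOn_dual p.rank p.lt).2 hs) h𝓑
    fun U X hp ht => h𝓑' U X hp ((starOn_dual p.rank p.lt).1 ht)

end Dual

end Semibundles

end IsRank

/-! ### The theorem for subspaces of `V` -/

theorem mainTheorem6 {F V : Type*} [DivisionRing F] [AddCommGroup V] [Module F V]
    [FiniteDimensional F V] (W : Submodule F V) (k m : ℕ)
    (hk1 : 1 < k) (hkn : k + 1 < Module.finrank F V)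
    (hcodim : k + Module.finrank F W ≤ m + Module.finrank F V)
    (hmk : m ≤ k) (hmW : m ≤ Module.finrank F W)
    (hpoint : ¬ (m = k ∧ Module.finrank F W = k))
    (hnum : Spine.StarCond k m W ∨ Spine.TopCond k m)
    (δ : Set (Submodule F V) → Set (Submodule F V) → Prop)
    (hδ : δ = (Spine.grassmann F V k).Coplanar (Spine.points k m W) ∨
      δ = (Spine.grassmann F V k).Copencil (Spine.points k m W)) :
    (∀ (U₁ U₂ : Submodule F V) (X₁ X₂ : Set (Submodule F V)),
      (Spine.grassmann F V k).IsProperVertex (Spine.points k m W) U₁ X₁ →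
      (Spine.grassmann F V k).IsProperVertex (Spine.points k m W) U₂ X₂ →
      (UpsilonEmpty δ
          ((Spine.grassmann F V k).linesThrough (Spine.points k m W) U₁ X₁)
          ((Spine.grassmann F V k).linesThrough (Spine.points k m W) U₂ X₂) ↔
        ((Spine.IsStar k m W X₁ ∧ Spine.IsStar k m W X₂) ∨
          (Spine.IsTop k m W X₁ ∧ Spine.IsTop k m W X₂)) ∧ U₁ = U₂)) ∧
    (∀ (U : Submodule F V) (X : Set (Submodule F V)),
      Maximal ((Spine.grassmann F V k).fragment (Spine.points k m W)).IsStrong X →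
      U ∈ X → Spine.Admissible k m W X →
      upsilonUnion δ (Spine.properSemibundles k m W)
          ((Spine.grassmann F V k).linesThrough (Spine.points k m W) U X) =
        {L | L ∈ ((Spine.grassmann F V k).fragment (Spine.points k m W)).lines ∧ U ∈ L} ∧
      upsilonUnion δ (Spine.admissibleSemibundles k m W)
          ((Spine.grassmann F V k).linesThrough (Spine.points k m W) U X) =
        {L | L ∈ ((Spine.grassmann F V k).fragment (Spine.points k m W)).lines ∧ U ∈ L}) := by

  have p : IsRank.SpineParams (fun U : Submodule F V => Module.finrank F U) (Module.finrank F V) k m W :=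
    ⟨Submodule.isRank_finrank, hk1, hkn, hmk, hmW, hcodim, hpoint⟩
  refine ⟨fun U₁ U₂ X₁ X₂ hX₁ hX₂ => ⟨fun h => ?_, ?_⟩, fun U X hX hUX hadm => ?_⟩
  · rcases IsRank.starOn_or_topOn_spine p hX₁ with h₁ | h₁ <;>
      rcases IsRank.starOn_or_topOn_spine p hX₂ with h₂ | h₂
    · exact ⟨Or.inl ⟨h₁, h₂⟩, IsRank.vertex_eq_of_upsilonEmpty p hδ hX₁ hX₂ h₁ h₂ h⟩
    · exact absurd h (IsRank.not_upsilonEmpty_of_starOn_topOn p hδ h₁ h₂)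
    · exact absurd h.symm (IsRank.not_upsilonEmpty_of_starOn_topOn p hδ h₂ h₁)
    · exact ⟨Or.inr ⟨h₁, h₂⟩, IsRank.vertex_eq_of_upsilonEmpty_topOn p hδ hX₁ hX₂ h₁ h₂ h⟩
  · rintro ⟨⟨h₁, h₂⟩ | ⟨h₁, h₂⟩, rfl⟩
    · exact IsRank.upsilonEmpty_of_starOn p hδ hX₁ hX₂ h₁ h₂
    · exact IsRank.upsilonEmpty_of_topOn p hδ hX₁ hX₂ h₁ h₂
  · rcases hadm with ⟨hs, hc⟩ | ⟨ht, hc⟩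
    · exact ⟨IsRank.upsilonUnion_of_starOn p hc.2 hδ hX hUX hs (fun K hK => hK)
          fun U' X' hp _ => ⟨U', X', hp, rfl⟩,
        IsRank.upsilonUnion_of_starOn p hc.2 hδ hX hUX hs (fun K ⟨U', X', h, _, h'⟩ => ⟨U', X', h, h'⟩)
          fun U' X' hp hs' => ⟨U', X', hp, Or.inl ⟨hs', hc⟩, rfl⟩⟩
    · exact ⟨IsRank.upsilonUnion_of_topOn p hc.2 hδ hX hUX ht (fun K hK => hK)
          fun U' X' hp _ => ⟨U', X', hp, rfl⟩,
        IsRank.upsilonUnion_of_topOn p hc.2 hδ hX hUX ht (fun K ⟨U', X', h, _, h'⟩ => ⟨U', X', h, h'⟩)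
          fun U' X' hp ht' => ⟨U', X', hp, Or.inr ⟨ht', hc⟩, rfl⟩⟩
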